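/- Let $R$ be an integral domain which is not a field and in which every principal ideal $(m)$ with $m \in R^\times := R\setminus\{0\}$ has finite index. Let $\mathfrak{A}[R]$ be the universal C*-algebra generated by isometries $s_m$ ($m \in R^\times$) and unitaries $u^n$ ($n \in R$) subject to the relations $$\text{(i)}\ s_k s_m = s_{km},\qquad \text{(ii)}\ u^l u^n = u^{l+n},\qquad \text{(iii)}\ s_m u^n = u^{mn} s_m,\qquad \text{(iv)}\ \sum_{n+(m)\in R/(m)} u^n s_m s_m^* u^{-n} = 1$$ for all $k,m\in R^\times$ and $l,n\in R$. Let $A$ be a nonzero unital C*-algebra which is generated, as a C*-algebra, by isometries $\{t_m : m\in R^\times\}$ and unitaries $\{v^n : n\in R\}$ satisfying the relations (i)--(iv), with $t_m$ and $v^n$ in place of $s_m$ and $u^n$. Then $A$ is canonically isomorphic to $\mathfrak{A}[R]$: there is a unique $*$-isomorphism $\mathfrak{A}[R]\to A$ with $s_m\mapsto t_m$ and $u^n\mapsto v^n$ for all $m\in R^\times$, $n\in R$. In particular, let $\mathfrak{A}_r[R]\subset\mathcal{L}(\ell^2(R))$ be the regular C*-algebra of $R$, that is, the C*-algebra generated by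 the operators $S_m$ ($m\in R^\times$) and $U^n$ ($n\in R$) given on the standard orthonormal basis $(\xi_r)_{r\in R}$ of $\ell^2(R)$ by $S_m\xi_r=\xi_{mr}$ and $U^n\xi_r=\xi_{n+r}$. Then there is a unique $*$-isomorphism $\mathfrak{A}[R]\to\mathfrak{A}_r[R]$ with $s_m\mapsto S_m$ and $u^n\mapsto U^n$ for all $m\in R^\times$, $n\in R$. -/

import Mathlib

open scoped nonZeroDivisors

universe u v

noncomputable section

namespace RingCStar

/-! ### The defining relations -/

/-- The defining relations for elements `s m` (`m ≠ 0`) and `u n` of a unital complex `*`-algebra,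
where "`x = y`" is read as `E x y`.
For elements of a C*-algebra, `E` is equality (so that the `s m` are isometries and the `u n` are
unitaries); for a C*-seminorm `p` on a `*`-algebra, `E x y` is `p (x - y) = 0`.
In `range_sum`, the sum runs over the cosets of `(m)`, each coset being represented by some element
of it; when `(m)` has finite index, this is a finite sum.  See `conj_range_eq` for the independence
of the representatives. -/
structure Relations {R : Type u} [CommRing R] {A : Type v} [Ring A] [StarRing A]
    (E : A → A → Prop) (s : R⁰ → A) (u : R → A) : Prop where
  isometry : ∀ m, E (star (s m) * s m) 1
  unitary_left : ∀ n, E (star (u n) * u n) 1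
  unitary_right : ∀ n, E (u n * star (u n)) 1
  s_mul_s : ∀ k m, E (s k * s m) (s (k * m))
  u_mul_u : ∀ l n, E (u l * u n) (u (l + n))
  s_mul_u : ∀ (m : R⁰) (n : R), E (s m * u n) (u ((m : R) * n) * s m)
  range_sum : ∀ m : R⁰,
    E (∑ᶠ c : R ⧸ Ideal.span {(m : R)}, u c.out * (s m * star (s m)) * u (-c.out)) 1

/-- The projection `u^n e_m u^{-n}` only depends on the coset `n + (m)`. -/
theorem conj_range_eq {R : Type u} [CommRing R] {A : Type v} [Ring A] [StarRing A]
    {s : R⁰ → A} {u : R → A} (h : Relations Eq s u) (m : R⁰) {n n' : R}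
    (hn : (Ideal.Quotient.mk (Ideal.span {(m : R)}) n) = Ideal.Quotient.mk _ n') :
    u n * (s m * star (s m)) * u (-n) = u n' * (s m * star (s m)) * u (-n') := by
  rw [Ideal.Quotient.eq, Ideal.mem_span_singleton] at hn
  obtain ⟨k, hk⟩ := hn
  obtain rfl : n = n' + m * k := by rw [← hk]; ring
  have h0 : u 0 = 1 := by
    have h1 := h.unitary_left 0
    have h2 := h.u_mul_u 0 0
    rw [add_zero] at h2
    calc u 0 = (star (u 0) * u 0) * u 0 := by rw [h1, one_mul]
      _ = 1 := by rw [mul_assoc, h2, h1]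
  have hst : ∀ x, u (-x) = star (u x) := fun x => by
    calc u (-x) = (star (u x) * u x) * u (-x) := by rw [h.unitary_left, one_mul]
      _ = star (u x) := by rw [mul_assoc, h.u_mul_u, add_neg_cancel, h0, mul_one]
  rw [hst, hst, ← h.u_mul_u n']
  calc u n' * u (m * k) * (s m * star (s m)) * star (u n' * u (m * k))
      = u n' * ((u (m * k) * s m) * star (u (m * k) * s m)) * star (u n') := by
        simp only [star_mul, mul_assoc]
    _ = u n' * (s m * (u k * star (u k)) * star (s m)) * star (u n') := by
        rw [← h.s_mul_u]; simp only [star_mul, mul_assoc]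
    _ = _ := by rw [h.unitary_right, mul_one]

/-! ### The free `*`-algebra on the generators -/

/-- The free unital complex `*`-algebra on symbols `s_m` (`m ≠ 0`) and `u^n` (`n ∈ R`): the
noncommutative polynomials in these symbols (`Sum.inl`) and their formal adjoints (`Sum.inr`). -/
def FreeStarAlg (R : Type u) [CommRing R] : Type u :=
  FreeAlgebra ℂ ((R⁰ ⊕ R) ⊕ (R⁰ ⊕ R))

section Free

variable (R : Type u) [CommRing R]

instance : Ring (FreeStarAlg R) :=
  inferInstanceAs (Ring (FreeAlgebra ℂ ((R⁰ ⊕ R) ⊕ (R⁰ ⊕ R))))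

instance : Algebra ℂ (FreeStarAlg R) :=
  inferInstanceAs (Algebra ℂ (FreeAlgebra ℂ ((R⁰ ⊕ R) ⊕ (R⁰ ⊕ R))))

variable {R}

namespace FreeStarAlg

/-- The letters of the free `*`-algebra. -/
def letter (x : (R⁰ ⊕ R) ⊕ (R⁰ ⊕ R)) : FreeStarAlg R := FreeAlgebra.ι ℂ x

/-- The generator `s_m`. -/
def s (m : R⁰) : FreeStarAlg R := letter (Sum.inl (Sum.inl m))

/-- The generator `u^n`. -/
def u (n : R) : FreeStarAlg R := letter (Sum.inl (Sum.inr n))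

/-- The conjugate-linear ring homomorphism to the opposite algebra that exchanges each symbol with
its formal adjoint. -/
def starHom : FreeStarAlg R →+* (FreeStarAlg R)ᵐᵒᵖ :=
  letI : Algebra ℂ (FreeStarAlg R)ᵐᵒᵖ :=
    RingHom.toAlgebra' ((algebraMap ℂ (FreeStarAlg R)ᵐᵒᵖ).comp (starRingEnd ℂ))
      (fun c x => Algebra.commutes (starRingEnd ℂ c) x)
  (FreeAlgebra.lift ℂ (fun x => MulOpposite.op (letter (R := R) x.swap))).toRingHom

theorem starHom_letter (x : (R⁰ ⊕ R) ⊕ (R⁰ ⊕ R)) :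
    starHom (letter x) = MulOpposite.op (letter x.swap) := by
  let _ : Algebra ℂ (FreeStarAlg R)ᵐᵒᵖ :=
    RingHom.toAlgebra' ((algebraMap ℂ (FreeStarAlg R)ᵐᵒᵖ).comp (starRingEnd ℂ))
      (fun c x => Algebra.commutes (starRingEnd ℂ c) x)
  exact FreeAlgebra.lift_ι_apply (R := ℂ)
    (fun x => MulOpposite.op (letter (R := R) x.swap)) x

theorem starHom_algebraMap (c : ℂ) :
    starHom (algebraMap ℂ (FreeStarAlg R) c) =
      MulOpposite.op (algebraMap ℂ (FreeStarAlg R) (starRingEnd ℂ c)) := by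
  let _ : Algebra ℂ (FreeStarAlg R)ᵐᵒᵖ :=
    RingHom.toAlgebra' ((algebraMap ℂ (FreeStarAlg R)ᵐᵒᵖ).comp (starRingEnd ℂ))
      (fun c x => Algebra.commutes (starRingEnd ℂ c) x)
  exact AlgHom.commutes (FreeAlgebra.lift ℂ
    (fun x : (R⁰ ⊕ R) ⊕ (R⁰ ⊕ R) => MulOpposite.op (letter (R := R) x.swap))) c

theorem induction {motive : FreeStarAlg R → Prop}
    (algebraMap : ∀ c : ℂ, motive (algebraMap ℂ (FreeStarAlg R) c))
    (letter : ∀ x, motive (letter x))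
    (mul : ∀ a b, motive a → motive b → motive (a * b))
    (add : ∀ a b, motive a → motive b → motive (a + b)) (a : FreeStarAlg R) : motive a :=
  FreeAlgebra.induction ℂ _ algebraMap letter mul add a

instance : StarRing (FreeStarAlg R) where
  star x := (starHom x).unop
  star_involutive x := by
    induction x using FreeStarAlg.induction with
    | algebraMap c => simp [starHom_algebraMap]
    | letter x => simp [starHom_letter]
    | mul a b ha hb => simp [ha, hb]
    | add a b ha hb => simp [ha, hb]
  star_mul a b := by simp
  star_add a b := by simp

theorem star_letter (x : (R⁰ ⊕ R) ⊕ (R⁰ ⊕ R)) : star (letter x) = letter x.swap := by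
  change (starHom (letter x)).unop = _
  rw [starHom_letter]; rfl

instance : StarModule ℂ (FreeStarAlg R) where
  star_smul c x := by
    change (starHom (c • x)).unop = star c • (starHom x).unop
    rw [Algebra.smul_def, map_mul, starHom_algebraMap, MulOpposite.unop_mul, MulOpposite.unop_op,
      ← Algebra.commutes, ← Algebra.smul_def]
    rfl

end FreeStarAlg

end Free

/-! ### The universal C*-algebra -/

/-- A C*-seminorm on the free `*`-algebra in which the defining relations hold. -/
structure CStarSeminorm (R : Type u) [CommRing R] extends Seminorm ℂ (FreeStarAlg R) where
  mul_le' : ∀ x y, toFun (x * y) ≤ toFun x * toFun y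
  star_mul_self' : ∀ x, toFun (star x * x) = toFun x ^ 2
  relations : Relations (fun x y => toFun (x - y) = 0) (FreeStarAlg.s (R := R)) FreeStarAlg.u

namespace CStarSeminorm

variable {R : Type u} [CommRing R]

instance : Inhabited (CStarSeminorm R) where
  default :=
    { toSeminorm := 0
      mul_le' := fun _ _ => (mul_zero (0 : ℝ)).ge
      star_mul_self' := fun _ => (zero_pow two_ne_zero).symm
      relations := by constructor <;> intros <;> rfl }

variable (p : CStarSeminorm R)

theorem mul_le (x y : FreeStarAlg R) :
    p.toSeminorm (x * y) ≤ p.toSeminorm x * p.toSeminorm y := p.mul_le' x y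

theorem star_mul_self (x : FreeStarAlg R) :
    p.toSeminorm (star x * x) = p.toSeminorm x ^ 2 := p.star_mul_self' x

theorem one_le : p.toSeminorm 1 ≤ 1 := by
  have h := p.star_mul_self 1
  rw [star_one, one_mul] at h
  nlinarith [apply_nonneg p.toSeminorm 1]

theorem le_star (x : FreeStarAlg R) : p.toSeminorm x ≤ p.toSeminorm (star x) := by
  have h := p.star_mul_self x
  have h2 := p.mul_le (star x) x
  rcases (apply_nonneg p.toSeminorm x).eq_or_lt with h0 | h0
  · rw [← h0]; exact apply_nonneg _ _
  · nlinarith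

theorem apply_star (x : FreeStarAlg R) : p.toSeminorm (star x) = p.toSeminorm x :=
  le_antisymm (by simpa using p.le_star (star x)) (p.le_star x)

theorem le_one_of_isometry {x : FreeStarAlg R} (h : p.toSeminorm (star x * x - 1) = 0) :
    p.toSeminorm x ≤ 1 := by
  have h1 : p.toSeminorm (star x * x) ≤ p.toSeminorm (star x * x - 1) + p.toSeminorm 1 := by
    simpa using map_add_le_add p.toSeminorm (star x * x - 1) 1
  have := p.one_le
  rw [p.star_mul_self] at h1
  nlinarith [apply_nonneg p.toSeminorm x]

theorem letter_le_one (x : (R⁰ ⊕ R) ⊕ (R⁰ ⊕ R)) : p.toSeminorm (FreeStarAlg.letter x) ≤ 1 := by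
  have key : ∀ y : R⁰ ⊕ R, p.toSeminorm (FreeStarAlg.letter (Sum.inl y)) ≤ 1 := by
    rintro (m | n)
    · exact p.le_one_of_isometry (p.relations.isometry m)
    · exact p.le_one_of_isometry (p.relations.unitary_left n)
  rcases x with y | y
  · exact key y
  · rw [← p.apply_star, FreeStarAlg.star_letter]
    exact key y

/-- The generators have norm at most one, so the C*-seminorms are bounded at each point. -/
theorem exists_bound (x : FreeStarAlg R) : ∃ C, ∀ p : CStarSeminorm R, p.toSeminorm x ≤ C := by
  induction x using FreeStarAlg.induction with
  | algebraMap c =>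
    refine ⟨‖c‖, fun p => ?_⟩
    rw [Algebra.algebraMap_eq_smul_one, map_smul_eq_mul]
    exact mul_le_of_le_one_right (norm_nonneg _) p.one_le
  | letter x => exact ⟨1, fun p => p.letter_le_one x⟩
  | mul a b ha hb =>
    obtain ⟨C, hC⟩ := ha
    obtain ⟨D, hD⟩ := hb
    exact ⟨C * D, fun p => (p.mul_le a b).trans (mul_le_mul (hC p) (hD p) (apply_nonneg _ _)
      ((apply_nonneg _ _).trans (hC p)))⟩
  | add a b ha hb =>
    obtain ⟨C, hC⟩ := ha
    obtain ⟨D, hD⟩ := hb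
    exact ⟨C + D, fun p => (map_add_le_add _ a b).trans (add_le_add (hC p) (hD p))⟩

theorem bddAbove (x : FreeStarAlg R) :
    BddAbove (Set.range fun p : CStarSeminorm R => p.toSeminorm x) := by
  obtain ⟨C, hC⟩ := exists_bound x
  exact ⟨C, by rintro _ ⟨p, rfl⟩; exact hC p⟩

theorem le_iSup (x : FreeStarAlg R) :
    p.toSeminorm x ≤ ⨆ q : CStarSeminorm R, q.toSeminorm x :=
  le_ciSup (bddAbove x) p

variable (R) in
/-- The largest C*-seminorm in which the defining relations hold. -/
def maximal : CStarSeminorm R where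
  toFun x := ⨆ p : CStarSeminorm R, p.toSeminorm x
  map_zero' := by simp
  add_le' x y := ciSup_le fun p =>
    (map_add_le_add _ x y).trans (add_le_add (p.le_iSup x) (p.le_iSup y))
  neg' x := by simp
  smul' c x := by
    simp only [map_smul_eq_mul]
    exact (Real.mul_iSup_of_nonneg (norm_nonneg c) _).symm
  mul_le' x y := ciSup_le fun p =>
    (p.mul_le x y).trans (mul_le_mul (p.le_iSup x) (p.le_iSup y) (apply_nonneg _ _)
      ((apply_nonneg _ _).trans (p.le_iSup x)))
  star_mul_self' x := by
    have h0 : 0 ≤ ⨆ p : CStarSeminorm R, p.toSeminorm x :=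
      (apply_nonneg _ _).trans ((default : CStarSeminorm R).le_iSup x)
    apply le_antisymm
    · refine ciSup_le fun p => ?_
      rw [p.star_mul_self]
      exact pow_le_pow_left₀ (apply_nonneg _ _) (p.le_iSup x) 2
    · have h1 : (⨆ p : CStarSeminorm R, p.toSeminorm x) ≤
          √(⨆ p : CStarSeminorm R, p.toSeminorm (star x * x)) := by
        refine ciSup_le fun p => Real.le_sqrt_of_sq_le ?_
        rw [← p.star_mul_self]
        exact p.le_iSup _
      calc _ ≤ (√(⨆ p : CStarSeminorm R, p.toSeminorm (star x * x))) ^ 2 :=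
            pow_le_pow_left₀ h0 h1 2
        _ = _ := Real.sq_sqrt ((apply_nonneg _ _).trans ((default : CStarSeminorm R).le_iSup _))
  relations := by
    have key : ∀ x : FreeStarAlg R, (∀ p : CStarSeminorm R, p.toSeminorm x = 0) →
        (⨆ p : CStarSeminorm R, p.toSeminorm x) = 0 := fun x h => by simp [h]
    constructor <;> intros <;> refine key _ fun p => ?_
    · exact p.relations.isometry _
    · exact p.relations.unitary_left _
    · exact p.relations.unitary_right _
    · exact p.relations.s_mul_s _ _
    · exact p.relations.u_mul_u _ _
    · exact p.relations.s_mul_u _ _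
    · exact p.relations.range_sum _

theorem le_maximal (x : FreeStarAlg R) :
    p.toSeminorm x ≤ (maximal R).toSeminorm x := p.le_iSup x

end CStarSeminorm

section Norm

variable (R : Type u) [CommRing R]

/-- The free `*`-algebra is normed by the largest C*-seminorm in which the relations hold. -/
instance : SeminormedRing (FreeStarAlg R) :=
  { (inferInstance : Ring (FreeStarAlg R)),
    (CStarSeminorm.maximal R).toSeminorm.toAddGroupSeminorm.toSeminormedAddCommGroup with
    norm_mul_le := (CStarSeminorm.maximal R).mul_le }

variable {R}

theorem FreeStarAlg.norm_def (x : FreeStarAlg R) :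
    ‖x‖ = (CStarSeminorm.maximal R).toSeminorm x := rfl

instance : NormedSpace ℂ (FreeStarAlg R) where
  norm_smul_le c x := (map_smul_eq_mul (CStarSeminorm.maximal R).toSeminorm c x).le

instance : NormedStarGroup (FreeStarAlg R) where
  norm_star_le x := ((CStarSeminorm.maximal R).apply_star x).le

end Norm

open UniformSpace

/-- The universal C*-algebra `𝔄[R]` generated by isometries `s_m`, `m ≠ 0`, and unitaries `u^n`,
`n ∈ R`, subject to the defining relations: the (Hausdorff) completion of the free `*`-algebra on
these symbols with respect to the largest C*-seminorm in which the relations hold. -/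
def UnivAlg (R : Type u) [CommRing R] : Type u := Completion (FreeStarAlg R)

namespace UnivAlg

variable (R : Type u) [CommRing R]

instance : NormedRing (UnivAlg R) := inferInstanceAs (NormedRing (Completion (FreeStarAlg R)))

instance : CompleteSpace (UnivAlg R) :=
  inferInstanceAs (CompleteSpace (Completion (FreeStarAlg R)))

instance : NormedAlgebra ℂ (UnivAlg R) :=
  { (inferInstanceAs (Algebra ℂ (Completion (FreeStarAlg R))) : Algebra ℂ (UnivAlg R)) with
    norm_smul_le := fun c x => norm_smul_le (β := Completion (FreeStarAlg R)) c x }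

/-- The canonical map from the free `*`-algebra, as a ring homomorphism. -/
def coe : FreeStarAlg R →+* UnivAlg R := Completion.coeRingHom

variable {R}

theorem norm_coe (x : FreeStarAlg R) : ‖coe R x‖ = ‖x‖ := Completion.norm_coe x

theorem coe_smul (c : ℂ) (x : FreeStarAlg R) : coe R (c • x) = c • coe R x :=
  Completion.coe_smul c x

theorem denseRange_coe : DenseRange (coe R) := Completion.denseRange_coe

theorem uniformContinuous_star : UniformContinuous (star : FreeStarAlg R → FreeStarAlg R) :=
  (starₗᵢ ℂ : FreeStarAlg R ≃ₗᵢ⋆[ℂ] FreeStarAlg R).isometry.uniformContinuous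

instance : Star (UnivAlg R) where
  star := Completion.map (star : FreeStarAlg R → FreeStarAlg R)

theorem continuous_star' : Continuous (star : UnivAlg R → UnivAlg R) :=
  Completion.continuous_map

theorem star_coe (x : FreeStarAlg R) : star (coe R x) = coe R (star x) :=
  Completion.map_coe uniformContinuous_star x

theorem induction_on {motive : UnivAlg R → Prop} (a : UnivAlg R)
    (hp : IsClosed {a | motive a}) (ih : ∀ x, motive (coe R x)) : motive a :=
  Completion.induction_on a hp ih

instance : StarRing (UnivAlg R) where
  star_involutive a := by
    induction a using induction_on with
    | hp => exact isClosed_eq (continuous_star'.comp continuous_star') continuous_id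
    | ih x => rw [star_coe, star_coe, star_star]
  star_mul a b := by
    induction a using induction_on with
    | hp =>
      exact isClosed_eq (continuous_star'.comp (continuous_id.mul continuous_const))
        (continuous_const.mul continuous_star')
    | ih x =>
      induction b using induction_on with
      | hp =>
        exact isClosed_eq (continuous_star'.comp (continuous_const.mul continuous_id))
          (continuous_star'.mul continuous_const)
      | ih y => rw [← map_mul, star_coe, star_coe, star_coe, star_mul, map_mul]
  star_add a b := by
    induction a using induction_on with
    | hp =>
      exact isClosed_eq (continuous_star'.comp (continuous_id.add continuous_const))
        (continuous_star'.add continuous_const)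
    | ih x =>
      induction b using induction_on with
      | hp =>
        exact isClosed_eq (continuous_star'.comp (continuous_const.add continuous_id))
          (continuous_const.add continuous_star')
      | ih y => rw [← map_add, star_coe, star_coe, star_coe, star_add, map_add]

instance : StarModule ℂ (UnivAlg R) where
  star_smul c a := by
    induction a using induction_on with
    | hp =>
      exact isClosed_eq (continuous_star'.comp (continuous_const_smul c))
        (continuous_star'.const_smul (star c))
    | ih x => rw [← coe_smul, star_coe, star_coe, star_smul, coe_smul]

instance : CStarRing (UnivAlg R) where
  norm_mul_self_le a := by
    induction a using induction_on with
    | hp =>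
      exact isClosed_le (continuous_norm.mul continuous_norm)
        ((continuous_star'.mul continuous_id).norm)
    | ih x =>
      rw [star_coe, ← map_mul, norm_coe, norm_coe, FreeStarAlg.norm_def, FreeStarAlg.norm_def,
        CStarSeminorm.star_mul_self, sq]

instance : CStarAlgebra (UnivAlg R) where

/-- The canonical isometry `s_m` of `𝔄[R]`. -/
def s (m : R⁰) : UnivAlg R := coe R (FreeStarAlg.s m)

/-- The canonical unitary `u^n` of `𝔄[R]`. -/
def u (n : R) : UnivAlg R := coe R (FreeStarAlg.u n)

/-- The generators of `𝔄[R]` satisfy the defining relations. -/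
theorem relations [hR : ∀ m : R⁰, Finite (R ⧸ Ideal.span {(m : R)})] :
    Relations Eq (s (R := R)) u := by
  have key : ∀ x y : FreeStarAlg R, (CStarSeminorm.maximal R).toSeminorm (x - y) = 0 →
      coe R x = coe R y := fun x y h => by
    rw [← sub_eq_zero, ← map_sub, ← norm_eq_zero, norm_coe, FreeStarAlg.norm_def, h]
  have h := (CStarSeminorm.maximal R).relations
  constructor
  · intro m
    simpa [s, star_coe] using key _ _ (h.isometry m)
  · intro n
    simpa [u, star_coe] using key _ _ (h.unitary_left n)
  · intro n
    simpa [u, star_coe] using key _ _ (h.unitary_right n)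
  · intro k m
    simpa [s] using key _ _ (h.s_mul_s k m)
  · intro l n
    simpa [u] using key _ _ (h.u_mul_u l n)
  · intro m n
    simpa [s, u] using key _ _ (h.s_mul_u m n)
  · intro m
    have h1 := key _ _ (h.range_sum m)
    have e := AddMonoidHom.map_finsum (coe R : FreeStarAlg R →+ UnivAlg R)
      (f := fun c : R ⧸ Ideal.span {(m : R)} => FreeStarAlg.u c.out *
        (FreeStarAlg.s m * star (FreeStarAlg.s m)) * FreeStarAlg.u (-c.out))
      (Set.toFinite _)
    simpa [s, u, star_coe] using e.symm.trans h1

/-- The universal property of `𝔄[R]`. -/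
theorem existsUnique_lift [hR : ∀ m : R⁰, Finite (R ⧸ Ideal.span {(m : R)})]
    {A : Type v} [CStarAlgebra A] {s' : R⁰ → A} {u' : R → A} (h : Relations Eq s' u') :
    ∃! φ : UnivAlg R →⋆ₐ[ℂ] A, (∀ m, φ (s m) = s' m) ∧ ∀ n, φ (u n) = u' n := by
  let g : (R⁰ ⊕ R) ⊕ (R⁰ ⊕ R) → A := Sum.elim (Sum.elim s' u') (star ∘ Sum.elim s' u')
  let f : FreeStarAlg R →ₐ[ℂ] A := FreeAlgebra.lift ℂ g
  have hf : ∀ x, f (FreeStarAlg.letter x) = g x := fun x => FreeAlgebra.lift_ι_apply g x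
  have hfs : ∀ m, f (FreeStarAlg.s m) = s' m := fun m => hf _
  have hfu : ∀ n, f (FreeStarAlg.u n) = u' n := fun n => hf _
  have hstar : ∀ x, f (star x) = star (f x) := fun x => by
    induction x using FreeStarAlg.induction with
    | algebraMap c =>
      rw [← algebraMap_star_comm, AlgHom.commutes, AlgHom.commutes, algebraMap_star_comm]
    | letter x =>
      rw [FreeStarAlg.star_letter, hf, hf]
      rcases x with x | x <;> simp [g]
    | mul a b ha hb => simp [ha, hb]
    | add a b ha hb => simp [ha, hb]
  let p : CStarSeminorm R :=
    { toSeminorm := (normSeminorm ℂ A).comp f.toLinearMap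
      mul_le' := fun x y => by
        change ‖f (x * y)‖ ≤ ‖f x‖ * ‖f y‖
        rw [map_mul]; exact norm_mul_le _ _
      star_mul_self' := fun x => by
        change ‖f (star x * x)‖ = ‖f x‖ ^ 2
        rw [map_mul, hstar, CStarRing.norm_star_mul_self, sq]
      relations := by
        have key : ∀ x y : FreeStarAlg R, f x = f y → ‖f (x - y)‖ = 0 := fun x y e => by
          rw [map_sub, e, sub_self, norm_zero]
        constructor
        · intro m
          exact key _ _ (by simpa [hstar, hfs] using h.isometry m)
        · intro n
          exact key _ _ (by simpa [hstar, hfu] using h.unitary_left n)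
        · intro n
          exact key _ _ (by simpa [hstar, hfu] using h.unitary_right n)
        · intro k m
          exact key _ _ (by simpa [hfs] using h.s_mul_s k m)
        · intro l n
          exact key _ _ (by simpa [hfu] using h.u_mul_u l n)
        · intro m n
          exact key _ _ (by simpa [hfs, hfu] using h.s_mul_u m n)
        · intro m
          refine key _ _ ?_
          have e := AddMonoidHom.map_finsum (f : FreeStarAlg R →+ A)
            (f := fun c : R ⧸ Ideal.span {(m : R)} => FreeStarAlg.u c.out *
              (FreeStarAlg.s m * star (FreeStarAlg.s m)) * FreeStarAlg.u (-c.out))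
            (Set.toFinite _)
          refine e.trans ?_
          simpa [hstar, hfs, hfu] using h.range_sum m }
  have hle : ∀ x, ‖f x‖ ≤ ‖x‖ := fun x => p.le_maximal x
  have hcont : Continuous f.toRingHom :=
    AddMonoidHomClass.continuous_of_bound f.toRingHom 1 (fun x => by simpa using! hle x)
  let F : UnivAlg R →+* A := Completion.extensionHom f.toRingHom hcont
  have hF : ∀ x, F (coe R x) = f x := fun x => Completion.extensionHom_coe f.toRingHom hcont x
  have hFc : Continuous F := Completion.continuous_extension
  let φ : UnivAlg R →⋆ₐ[ℂ] A :=
    { F with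
      commutes' := fun c => (hF (algebraMap ℂ _ c)).trans (f.commutes c)
      map_star' := fun a => by
        change F (star a) = star (F a)
        induction a using induction_on with
        | hp => exact isClosed_eq (hFc.comp continuous_star') hFc.star
        | ih x => rw [star_coe, hF, hF, hstar] }
  refine ⟨φ, ⟨fun m => (hF _).trans (hfs m), fun n => (hF _).trans (hfu n)⟩, ?_⟩
  rintro ψ ⟨h1, h2⟩
  have hψc : Continuous ψ :=
    AddMonoidHomClass.continuous_of_bound ψ 1 (fun x => by
      simpa using NonUnitalStarAlgHom.norm_apply_le ψ x)
  have hψ : ∀ x, ψ (coe R x) = f x := fun x => by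
    induction x using FreeStarAlg.induction with
    | algebraMap c => exact (ψ.toAlgHom.commutes c).trans (f.commutes c).symm
    | letter x =>
      have h3 : ∀ y, ψ (coe R (FreeStarAlg.letter (Sum.inl y))) =
          f (FreeStarAlg.letter (Sum.inl y)) := by
        rintro (m | n)
        · exact (h1 m).trans (hfs m).symm
        · exact (h2 n).trans (hfu n).symm
      rcases x with y | y
      · exact h3 y
      · have e : FreeStarAlg.letter (R := R) (Sum.inr y) =
            star (FreeStarAlg.letter (Sum.inl y)) := by rw [FreeStarAlg.star_letter]; rfl
        rw [e, ← star_coe, map_star, h3, hstar]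
    | mul a b ha hb => rw [map_mul, map_mul, map_mul, ha, hb]
    | add a b ha hb => rw [map_add, map_add, map_add, ha, hb]
  ext a
  induction a using induction_on with
  | hp => exact isClosed_eq hψc hFc
  | ih x => exact (hψ x).trans (hF x).symm

end UnivAlg

/-! ### The regular C*-algebra -/

section Regular

variable (R : Type u)

/-- The Hilbert space `ℓ²(R)`. -/
abbrev Ell2 : Type u := lp (fun _ : R => ℂ) 2

variable {R}

open Classical in
/-- The standard basis vector `ξ_r` of `ℓ²(R)`. -/
def xi (r : R) : Ell2 R := lp.single 2 r (1 : ℂ)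

theorem orthonormal_xi : Orthonormal ℂ (xi (R := R)) := by
  classical
  rw [orthonormal_iff_ite]
  intro i j
  simp only [xi, lp.inner_single_left, lp.single_apply, Pi.single_apply]
  split_ifs <;> simp_all

/-- The linear isometry of `ℓ²(R)` with `ξ_r ↦ ξ_{f r}`, for an injective map `f`. -/
def pushIsometry (f : R → R) (hf : Function.Injective f) : Ell2 R →ₗᵢ[ℂ] Ell2 R :=
  (orthonormal_xi.comp f hf).orthogonalFamily.linearIsometry

theorem pushIsometry_xi (f : R → R) (hf : Function.Injective f) (r : R) :
    pushIsometry f hf (xi r) = xi (f r) := by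
  classical
  have := (orthonormal_xi.comp f hf).orthogonalFamily.linearIsometry_apply_single
    (i := r) (1 : ℂ)
  simpa only [pushIsometry, xi, LinearIsometry.toSpanSingleton_apply, one_smul,
    Function.comp_apply] using this

variable [CommRing R]

/-- The operator `S_m` on `ℓ²(R)`, `S_m ξ_r = ξ_{mr}`. -/
def regS (m : R⁰) : Ell2 R →L[ℂ] Ell2 R :=
  (pushIsometry (fun r => (m : R) * r)
    (fun _ _ h => (mul_cancel_left_mem_nonZeroDivisors m.2).1 h)).toContinuousLinearMap

/-- The operator `U^n` on `ℓ²(R)`, `U^n ξ_r = ξ_{n+r}`. -/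
def regU (n : R) : Ell2 R →L[ℂ] Ell2 R :=
  (pushIsometry (fun r => n + r) (add_right_injective n)).toContinuousLinearMap

theorem regS_xi (m : R⁰) (r : R) : regS m (xi r) = xi ((m : R) * r) :=
  pushIsometry_xi (fun r => (m : R) * r)
    (fun _ _ h => (mul_cancel_left_mem_nonZeroDivisors m.2).1 h) r

theorem regU_xi (n r : R) : regU n (xi r) = xi (n + r) :=
  pushIsometry_xi (fun r => n + r) (add_right_injective n) r

variable (R) in
/-- The regular C*-algebra `𝔄_r[R]`: the C*-subalgebra of `L(ℓ²(R))` generated by all `S_m`, `U^n`.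
(It contains the identity, since `S_m` is an isometry.) -/
def regAlg : StarSubalgebra ℂ (Ell2 R →L[ℂ] Ell2 R) :=
  (StarAlgebra.adjoin ℂ (Set.range (regS (R := R)) ∪ Set.range regU)).topologicalClosure

theorem regS_mem (m : R⁰) : regS m ∈ regAlg R :=
  StarSubalgebra.le_topologicalClosure _
    (StarAlgebra.subset_adjoin ℂ _ (Or.inl ⟨m, rfl⟩))

theorem regU_mem (n : R) : regU n ∈ regAlg R :=
  StarSubalgebra.le_topologicalClosure _
    (StarAlgebra.subset_adjoin ℂ _ (Or.inr ⟨n, rfl⟩))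

end Regular

end RingCStar

end

noncomputable section

namespace RingCStar

/-! ### Polynomial growth of commutative gradings -/

/-! The universal property supplies a unital `*`-homomorphism `π` from `𝔄[R]` matching the
generators. The point is that every such `π` into a nonzero C*-algebra is isometric
(`UnivAlg.isometry_of_nontrivial`); its range is then closed, hence the C*-algebra generated by the
images of the generators. The regular algebra is the case of operators on `ℓ²(R)`.

No conditional expectation is used; norms are recovered from homogeneous components by growth. If a
self-adjoint `h` is a finite sum of homogeneous elements for a grading by a commutative monoid, then
`h ^ k` is a sum of polynomially many homogeneous elements, so a bound `C * M ^ k` on these forces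
`‖h‖ ≤ M` (`norm_le_of_graded`).

Write `1_{i+(N)}` for `u^i e_N u^{-i}`. The elements `s_k^* 1_{i+(N)} u^n s_m` span a dense
`*`-subalgebra, and each behaves like the affine map `a ↦ (n + m a) / k` cut down to a set. Unless
`k = m` and `n = 0`, this map fixes at most one point, and compression to a small ball around any
other point kills the element. Since `R` is infinite and has a nonzero nonunit, one ball inside any
prescribed ball kills finitely many such elements at once (`exists_ball_mul_mul_ball_eq_zero`),
while `π` preserves the norm of every ball (`norm_map_ball`).

The growth argument is applied twice. On the core, graded by the translation `n`, it gives `‖x‖ ≤ ‖π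
(x + w)‖` for `w` off-diagonal (`norm_component_le`, `norm_core_le`). Multiplication by `s_k` and
`s_m^*` moves degree `m / k` in the fraction field to degree `1`, so all components of an element
are controlled by its image (`norm_homog_component_le`), and the growth argument for this second
grading gives `‖y‖ ≤ ‖π y‖` (`norm_le_norm_map`). -/

open scoped Pointwise in
theorem exists_prod_pow_of_mem_pow {Γ : Type*} [CommMonoid Γ] [DecidableEq Γ] (F : Finset Γ)
    (k : ℕ) : ∀ x ∈ F ^ k, ∃ f : Γ → ℕ, (∀ a, f a ≤ k) ∧ ∏ a ∈ F, a ^ f a = x := by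
  induction k with
  | zero =>
    intro x hx
    refine ⟨0, fun _ => le_rfl, ?_⟩
    simp only [pow_zero, Finset.mem_one] at hx
    simp [hx]
  | succ k ih =>
    intro x hx
    rw [pow_succ, Finset.mem_mul] at hx
    obtain ⟨y, hy, b, hb, rfl⟩ := hx
    obtain ⟨f, hf, rfl⟩ := ih y hy
    refine ⟨f + Pi.single b 1, fun a => ?_, ?_⟩
    · have h1 : (Pi.single b 1 : Γ → ℕ) a ≤ 1 := by
        rw [Pi.single_apply]; split_ifs <;> simp
      exact add_le_add (hf a) h1
    · simp only [Pi.add_apply, pow_add, Finset.prod_mul_distrib]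
      congr 1
      rw [Finset.prod_eq_single b (fun c _ hc => by simp [hc]) (fun h => (h hb).elim)]
      simp

-- By commutativity a product of `k` elements of `F` depends only on the multiplicities, each of
-- which lies between `0` and `k`.
open scoped Pointwise in
theorem card_pow_le_succ_pow {Γ : Type*} [CommMonoid Γ] [DecidableEq Γ] (F : Finset Γ) (k : ℕ) :
    (F ^ k).card ≤ (k + 1) ^ F.card := by
  have hsub : F ^ k ⊆ (F.pi fun _ => Finset.range (k + 1)).image
      fun f => ∏ a ∈ F.attach, (a : Γ) ^ f a a.2 := by
    intro x hx
    obtain ⟨f, hf, rfl⟩ := exists_prod_pow_of_mem_pow F k x hx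
    refine Finset.mem_image.2 ⟨fun a _ => f a, ?_, ?_⟩
    · simpa [Finset.mem_pi, Nat.lt_succ_iff] using fun a _ => hf a
    · exact Finset.prod_attach F fun a => a ^ f a
  calc (F ^ k).card ≤ _ := Finset.card_le_card hsub
    _ ≤ _ := Finset.card_image_le
    _ = _ := by simp [Finset.card_pi]

/-- Only exponents `2 ^ n` occur because `‖h ^ k‖ = ‖h‖ ^ k` is used for self-adjoint `h` and `k = 2
^ n`. If `M < a`, division by `a ^ k` leaves a multiple of `k ^ d * (M / a) ^ k`, which tends to
zero. -/
theorem le_of_pow_le_poly_mul_pow {a M C : ℝ} {d : ℕ} (hM : 0 ≤ M)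
    (h : ∀ n : ℕ, a ^ 2 ^ n ≤ ((2 ^ n : ℕ) + 1 : ℝ) ^ d * (C * M ^ 2 ^ n)) : a ≤ M := by
  by_contra! hlt
  have ha : 0 < a := hM.trans_lt hlt
  have hr : |M / a| < 1 := by
    rw [abs_of_nonneg (by positivity), div_lt_one ha]; exact hlt
  have ht := (tendsto_pow_const_mul_const_pow_of_abs_lt_one d hr).const_mul (2 ^ d * |C|)
  rw [mul_zero] at ht
  obtain ⟨K, hK⟩ := Filter.eventually_atTop.1 (ht.eventually_lt_const one_pos)
  -- The exponent `2 ^ K` has the required form and lies beyond the threshold `K`.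
  have h1 := hK (2 ^ K) Nat.lt_two_pow_self.le
  have h2 := h K
  generalize hk : 2 ^ K = k at h1 h2
  have hk1 : (1 : ℝ) ≤ k := by
    rw [← hk]; exact_mod_cast Nat.one_le_two_pow
  have h3 : a ^ k ≤ (2 * k : ℝ) ^ d * (|C| * M ^ k) := by
    refine h2.trans ?_
    have h5 : C * M ^ k ≤ |C| * M ^ k := by gcongr; exact le_abs_self C
    have h6 : ((k : ℝ) + 1) ^ d ≤ (2 * k : ℝ) ^ d := by gcongr; linarith
    calc _ ≤ ((k : ℝ) + 1) ^ d * (|C| * M ^ k) := by gcongr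
      _ ≤ _ := by gcongr
  have h4 : (2 * k : ℝ) ^ d * (|C| * M ^ k) = 2 ^ d * |C| * (k ^ d * (M / a) ^ k) * a ^ k := by
    rw [mul_pow, div_pow]; field_simp
  rw [h4] at h3
  have h7 : 0 < a ^ k := by positivity
  nlinarith

-- The submodules need not be independent: some decomposition indexed by `F ^ k` is enough, obtained
-- by grouping products of equal degree.
open scoped Pointwise in
theorem pow_eq_sum_graded {Γ : Type*} [CommMonoid Γ] [DecidableEq Γ] {B : Type*} [Ring B]
    [Algebra ℂ B] {ℬ : Γ → Submodule ℂ B} (hone : 1 ∈ ℬ 1)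
    (hmul : ∀ g g' x y, x ∈ ℬ g → y ∈ ℬ g' → x * y ∈ ℬ (g * g')) {F : Finset Γ} {x : Γ → B}
    (hx : ∀ g, x g ∈ ℬ g) (k : ℕ) :
    ∃ z : Γ → B, (∀ g, z g ∈ ℬ g) ∧ (∑ g ∈ F, x g) ^ k = ∑ g ∈ F ^ k, z g := by
  induction k with
  | zero =>
    refine ⟨Pi.single 1 1, fun g => ?_, by simp⟩
    rcases eq_or_ne g 1 with rfl | hg
    · simpa using hone
    · simp [hg]
  | succ k ih =>
    obtain ⟨z, hz, e⟩ := ih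
    refine ⟨fun g => ∑ p ∈ (F ^ k) ×ˢ F with p.1 * p.2 = g, z p.1 * x p.2, fun g => ?_, ?_⟩
    · refine Submodule.sum_mem _ fun p hp => ?_
      rw [← (Finset.mem_filter.1 hp).2]
      exact hmul _ _ _ _ (hz _) (hx _)
    · rw [pow_succ, e, Finset.sum_mul_sum, ← Finset.sum_product', pow_succ,
        Finset.sum_fiberwise_of_maps_to]
      intro p hp
      rw [Finset.mem_product] at hp
      exact Finset.mul_mem_mul hp.1 hp.2

theorem exists_sum_of_mem_iSup {Γ B : Type*} [AddCommGroup B] [Module ℂ B]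
    {ℬ : Γ → Submodule ℂ B} {x : B} (hx : x ∈ ⨆ g, ℬ g) :
    ∃ (F : Finset Γ) (z : Γ → B), (∀ g, z g ∈ ℬ g) ∧ x = ∑ g ∈ F, z g := by
  obtain ⟨f, hf, e⟩ := (Submodule.mem_iSup_iff_exists_finsupp ℬ x).1 hx
  exact ⟨f.support, f, hf, e.symm⟩

/-- If a self-adjoint element is a sum of homogeneous elements for a grading by a commutative
monoid, its norm is controlled by the growth of the components of its powers. -/
theorem norm_le_of_graded {Γ : Type*} [CommMonoid Γ] {B : Type*} [CStarAlgebra B]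
    {ℬ : Γ → Submodule ℂ B} (hone : 1 ∈ ℬ 1)
    (hmul : ∀ g g' x y, x ∈ ℬ g → y ∈ ℬ g' → x * y ∈ ℬ (g * g')) {h : B}
    (hsa : IsSelfAdjoint h) (hh : h ∈ ⨆ g, ℬ g) {C M : ℝ} (hM : 0 ≤ M)
    (bound : ∀ (k : ℕ) (F : Finset Γ) (z : Γ → B), (∀ g, z g ∈ ℬ g) → h ^ k = ∑ g ∈ F, z g →
      ∀ g ∈ F, ‖z g‖ ≤ C * M ^ k) : ‖h‖ ≤ M := by
  classical
  obtain ⟨F, x, hx, e⟩ := exists_sum_of_mem_iSup hh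
  by_cases hC : 0 ≤ C
  · refine le_of_pow_le_poly_mul_pow (C := C) (d := F.card) hM fun n => ?_
    rw [← hsa.norm_pow_two_pow]
    obtain ⟨z, hz, ez⟩ := pow_eq_sum_graded hone hmul (F := F) hx (2 ^ n)
    rw [← e] at ez
    rw [ez]
    refine (norm_sum_le_of_le _ (bound _ _ z hz ez)).trans ?_
    rw [Finset.sum_const, nsmul_eq_mul]
    gcongr
    exact_mod_cast card_pow_le_succ_pow F (2 ^ n)
  -- A negative `C` is impossible: at `k = 0` the bound would apply to `1` as its own single
  -- component.
  · have h0 := bound 0 {1} (Pi.single 1 1) (fun g => by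
      rcases eq_or_ne g 1 with rfl | hg
      · simpa using hone
      · simp [hg]) (by simp) 1 (by simp)
    rw [pow_zero, mul_one] at h0
    exact absurd ((norm_nonneg _).trans h0) hC

/-! ### Two facts about C*-algebras -/

/-- The cross terms vanish, so `star (x + w) * (x + w)` dominates `star x * x`. -/
theorem norm_le_norm_add_of_star_mul_eq_zero {A : Type*} [CStarAlgebra A] {x w : A}
    (h : star x * w = 0) : ‖x‖ ≤ ‖x + w‖ := by
  let _ := CStarAlgebra.spectralOrder A
  have _ := CStarAlgebra.spectralOrderedRing A
  have h' : star w * x = 0 := by simpa using congrArg star h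
  have e : star (x + w) * (x + w) = star x * x + star w * w := by
    rw [star_add, add_mul, mul_add, mul_add, h, h']; abel
  have h1 : ‖star x * x‖ ≤ ‖star (x + w) * (x + w)‖ :=
    CStarAlgebra.norm_le_norm_of_nonneg_of_le (star_mul_self_nonneg x)
      (by rw [e]; exact le_add_of_nonneg_right (star_mul_self_nonneg w))
  rw [CStarRing.norm_star_mul_self, CStarRing.norm_star_mul_self] at h1
  exact abs_le_of_sq_le_sq' (by nlinarith) (norm_nonneg _) |>.2

/-- Compressing the sum by `p j` and cancelling the term `p j` leaves a vanishing sum of positive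
elements `star (p i * p j) * (p i * p j)`. -/
theorem mul_eq_zero_of_sum_projections {A ι : Type*} [CStarAlgebra A] [Fintype ι]
    {p : ι → A} (hp : ∀ i, IsStarProjection (p i)) (hsum : ∑ i, p i = 1) {i j : ι} (hij : i ≠ j) :
    p i * p j = 0 := by
  classical
  let _ := CStarAlgebra.spectralOrder A
  have _ := CStarAlgebra.spectralOrderedRing A
  have e : ∀ i, star (p i * p j) * (p i * p j) = p j * p i * p j := fun i => by
    rw [star_mul, (hp i).isSelfAdjoint.star_eq, (hp j).isSelfAdjoint.star_eq, mul_assoc,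
      ← mul_assoc (p i), (hp i).isIdempotentElem.eq, mul_assoc]
  have h1 : ∑ i, p j * p i * p j = p j := by
    rw [← Finset.sum_mul, ← Finset.mul_sum, hsum, mul_one, (hp j).isIdempotentElem.eq]
  rw [← Finset.add_sum_erase _ _ (Finset.mem_univ j), (hp j).isIdempotentElem.eq,
    (hp j).isIdempotentElem.eq, add_eq_left,
    Finset.sum_eq_zero_iff_of_nonneg (fun i _ => by rw [← e]; exact star_mul_self_nonneg _)] at h1
  have h2 := h1 i (Finset.mem_erase.2 ⟨hij, Finset.mem_univ i⟩)
  rw [← e] at h2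
  exact CStarRing.star_mul_self_eq_zero_iff _ |>.1 h2

/-! ### Balls: the projections `u^n e_m u^{-n}` -/

section Ball

variable {R : Type u} [CommRing R] {A : Type v} [CStarAlgebra A]

/-- The projection `u^i e_N u^{-i}`. -/
def ball (s : R⁰ → A) (u : R → A) (i : R) (N : R⁰) : A :=
  u i * (s N * star (s N)) * u (-i)

variable {s : R⁰ → A} {u : R → A}

namespace Relations

theorem u_zero (h : Relations Eq s u) : u 0 = 1 := by
  have h1 := h.unitary_left 0
  have h2 := h.u_mul_u 0 0
  rw [add_zero] at h2
  calc u 0 = (star (u 0) * u 0) * u 0 := by rw [h1, one_mul]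
    _ = 1 := by rw [mul_assoc, h2, h1]

theorem u_mul_neg (h : Relations Eq s u) (n : R) : u n * u (-n) = 1 := by
  rw [h.u_mul_u, add_neg_cancel, h.u_zero]

theorem u_neg_mul (h : Relations Eq s u) (n : R) : u (-n) * u n = 1 := by
  rw [h.u_mul_u, neg_add_cancel, h.u_zero]

theorem star_u (h : Relations Eq s u) (n : R) : star (u n) = u (-n) := by
  calc star (u n) = (star (u n) * u n) * u (-n) := by rw [mul_assoc, h.u_mul_neg, mul_one]
    _ = u (-n) := by rw [h.unitary_left, one_mul]

theorem s_comm (h : Relations Eq s u) (k m : R⁰) : s k * s m = s m * s k := by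
  rw [h.s_mul_s, h.s_mul_s, mul_comm]

theorem s_one (h : Relations Eq s u) : s 1 = 1 := by
  calc s 1 = (star (s 1) * s 1) * s 1 := by rw [h.isometry, one_mul]
    _ = 1 := by rw [mul_assoc, h.s_mul_s, mul_one, h.isometry]

theorem ball_zero (h : Relations Eq s u) (N : R⁰) : ball s u 0 N = s N * star (s N) := by
  simp [ball, h.u_zero]

theorem isStarProjection_ball (h : Relations Eq s u) (i : R) (N : R⁰) :
    IsStarProjection (ball s u i N) where
  isIdempotentElem := by
    calc u i * (s N * star (s N)) * u (-i) * (u i * (s N * star (s N)) * u (-i))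
        = u i * (s N * (star (s N) * (u (-i) * u i) * s N) * star (s N)) * u (-i) := by
          simp only [mul_assoc]
      _ = _ := by rw [h.u_neg_mul, mul_one, h.isometry, mul_one]; rfl
  isSelfAdjoint := by
    simp [IsSelfAdjoint, ball, star_mul, h.star_u, mul_assoc]

theorem star_ball (h : Relations Eq s u) (i : R) (N : R⁰) :
    star (ball s u i N) = ball s u i N := (h.isStarProjection_ball i N).isSelfAdjoint

theorem ball_mul_self (h : Relations Eq s u) (i : R) (N : R⁰) :
    ball s u i N * ball s u i N = ball s u i N := (h.isStarProjection_ball i N).isIdempotentElem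

theorem u_mul_ball (h : Relations Eq s u) (n i : R) (N : R⁰) :
    u n * ball s u i N = ball s u (n + i) N * u n := by
  simp only [ball, ← mul_assoc, h.u_mul_u]
  rw [mul_assoc _ (u (-(n + i))), h.u_mul_u]
  congr 2; ring

theorem ball_mul_u (h : Relations Eq s u) (n i : R) (N : R⁰) :
    ball s u i N * u n = u n * ball s u (i - n) N := by
  rw [h.u_mul_ball]; congr 2; ring

/-- Operator form of the identity `m (i + (N)) = mi + (mN)`. -/
theorem s_mul_ball (h : Relations Eq s u) (m : R⁰) (i : R) (N : R⁰) :
    s m * ball s u i N = ball s u (m * i) (m * N) * s m := by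
  calc s m * (u i * (s N * star (s N)) * u (-i))
      = (s m * u i) * (s N * star (s N)) * u (-i) := by simp only [mul_assoc]
    _ = u (m * i) * ((s m * s N) * (star (s N) * (star (s m) * s m)) * u (-i)) := by
        rw [h.s_mul_u, h.isometry, mul_one]; simp only [mul_assoc]
    _ = u (m * i) * (s (m * N) * star (s m * s N) * (s m * u (-i))) := by
        rw [← h.s_mul_s, star_mul]; simp only [mul_assoc]
    _ = _ := by
        rw [h.s_mul_s, h.s_mul_u, ball, mul_neg]; simp only [mul_assoc]

theorem ball_mul_star_s (h : Relations Eq s u) (m : R⁰) (i : R) (N : R⁰) :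
    ball s u i N * star (s m) = star (s m) * ball s u (m * i) (m * N) := by
  have := congrArg star (h.s_mul_ball m i N)
  rwa [star_mul, star_mul, h.star_ball, h.star_ball] at this

theorem ball_congr (h : Relations Eq s u) {i j : R} {N : R⁰} (hij : (N : R) ∣ i - j) :
    ball s u i N = ball s u j N := by
  refine conj_range_eq h N ?_
  rwa [Ideal.Quotient.eq, Ideal.mem_span_singleton]

/-- Operator form of `i + (NM) ⊆ i + (N)`. -/
theorem ball_mul_ball_nested (h : Relations Eq s u) (i : R) (N M : R⁰) :
    ball s u i (N * M) * ball s u i N = ball s u i (N * M) := by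
  calc u i * (s (N * M) * star (s (N * M))) * u (-i) * (u i * (s N * star (s N)) * u (-i))
      = u i * s (N * M) * star (s N * s M) * (u (-i) * u i) * s N * star (s N) * u (-i) := by
        rw [h.s_mul_s]; simp only [mul_assoc]
    _ = u i * s (N * M) * star (s M) * (star (s N) * s N) * star (s N) * u (-i) := by
        rw [h.u_neg_mul, star_mul]; simp only [mul_assoc, one_mul]
    _ = u i * s (N * M) * star (s N * s M) * u (-i) := by
        rw [h.isometry, mul_one, star_mul]; simp only [mul_assoc]
    _ = _ := by rw [h.s_mul_s, ball]; simp only [mul_assoc]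

theorem ball_mul_ball_nested' (h : Relations Eq s u) (i : R) (N M : R⁰) :
    ball s u i N * ball s u i (N * M) = ball s u i (N * M) := by
  simpa [h.star_ball] using congrArg star (h.ball_mul_ball_nested i N M)

theorem sum_ball (h : Relations Eq s u) (N : R⁰) [Fintype (R ⧸ Ideal.span {(N : R)})] :
    ∑ c : R ⧸ Ideal.span {(N : R)}, ball s u c.out N = 1 := by
  rw [← h.range_sum N, finsum_eq_sum_of_fintype]; rfl

/-- The partition of unity modulo `M` is inserted between `s N` and `star (s N)`, which splits `i +
(N)` into cosets of `(NM)`. -/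
theorem ball_eq_sum (h : Relations Eq s u) (i : R) (N M : R⁰)
    [Fintype (R ⧸ Ideal.span {(M : R)})] :
    ball s u i N = ∑ c : R ⧸ Ideal.span {(M : R)}, ball s u (i + N * c.out) (N * M) := by
  have e : ∀ c : R, ball s u (i + N * c) (N * M) = u i * (s N * ball s u c M * star (s N)) *
      u (-i) := fun c => by
    rw [h.s_mul_ball, mul_assoc _ (s N), ← h.ball_zero, mul_assoc (u i), mul_assoc _ _ (u (-i)),
      h.ball_mul_u, ← mul_assoc (ball s u _ _), h.ball_mul_u, ← mul_assoc, ← mul_assoc,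
      h.u_mul_neg, one_mul, show (N : R) * c - -i = i + N * c by ring,
      show (0 : R) - -i = i by ring]
    have e1 : ball s u (i + N * c) N = ball s u i N := h.ball_congr ⟨c, by ring⟩
    rw [← e1, h.ball_mul_ball_nested]
  simp_rw [e]
  rw [← Finset.sum_mul, ← Finset.mul_sum, ← Finset.sum_mul, ← Finset.mul_sum, h.sum_ball, mul_one]
  rfl

variable [hfin : ∀ m : R⁰, Finite (R ⧸ Ideal.span {(m : R)})]

theorem ball_mul_ball_eq_zero (h : Relations Eq s u) {i j : R} {N : R⁰} (hij : ¬ (N : R) ∣ i - j) :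
    ball s u i N * ball s u j N = 0 := by
  have := Fintype.ofFinite (R ⧸ Ideal.span {(N : R)})
  have key : ∀ i : R, ball s u i N =
      ball s u (Ideal.Quotient.mk (Ideal.span {(N : R)}) i).out N := fun i => by
    refine conj_range_eq h N ?_
    exact (Quotient.out_eq' (Ideal.Quotient.mk (Ideal.span {(N : R)}) i)).symm
  rw [key i, key j]
  refine mul_eq_zero_of_sum_projections (p := fun c : R ⧸ Ideal.span {(N : R)} =>
    ball s u c.out N) (fun c => h.isStarProjection_ball _ _) (h.sum_ball N) fun e => hij ?_
  rwa [Ideal.Quotient.eq, Ideal.mem_span_singleton] at e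

theorem ball_mul_u_mul_ball_eq_zero (h : Relations Eq s u) {i j n : R} {N : R⁰}
    (hij : ¬ (N : R) ∣ i - (n + j)) : ball s u i N * u n * ball s u j N = 0 := by
  rw [mul_assoc, h.u_mul_ball, ← mul_assoc, h.ball_mul_ball_eq_zero hij, zero_mul]

theorem commute_ball_same (h : Relations Eq s u) (i j : R) (N : R⁰) :
    Commute (ball s u i N) (ball s u j N) := by
  by_cases hij : (N : R) ∣ i - j
  · rw [h.ball_congr hij]
  · rw [Commute, SemiconjBy, h.ball_mul_ball_eq_zero hij, h.ball_mul_ball_eq_zero]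
    rwa [dvd_sub_comm]

/-- Both balls are sums of balls of the common modulus `N * M`, and those are equal or orthogonal.
-/
theorem commute_ball (h : Relations Eq s u) (i j : R) (N M : R⁰) :
    Commute (ball s u i N) (ball s u j M) := by
  have := Fintype.ofFinite (R ⧸ Ideal.span {(N : R)})
  have := Fintype.ofFinite (R ⧸ Ideal.span {(M : R)})
  rw [h.ball_eq_sum i N M, h.ball_eq_sum j M N]
  refine Commute.sum_left _ _ _ fun c _ => Commute.sum_right _ _ _ fun d _ => ?_
  rw [mul_comm M N]
  exact h.commute_ball_same _ _ _

/-- A ball around `a` cuts an elementary operator `s_k^* 1_{i+(N)} u^n s_m` to zero when it is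
small compared to the displacement of `a`. -/
theorem ball_mul_mul_ball_eq_zero (h : Relations Eq s u) {k m q : R⁰} {a n : R} (i : R) (N : R⁰)
    (hq : ¬ (q : R) ∣ k * a - (n + m * a)) :
    ball s u a q * (star (s k) * (ball s u i N * u n) * s m) * ball s u a q = 0 := by
  -- Past `s_k^*` and `s_m`, the ball at `a` becomes balls inside `ka + (q)` and `ma + (q)`.
  -- Translation by `n` takes the latter to `(n + ma) + (q)`, which is disjoint from `ka + (q)`.
  have e : ball s u (k * a) (k * q) * u n * ball s u (m * a) (m * q) = 0 := by
    rw [mul_comm k q, mul_comm m q, ← h.ball_mul_ball_nested, ← h.ball_mul_ball_nested' _ q m]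
    calc _ = ball s u (k * a) (q * k) * (ball s u (k * a) q * u n * ball s u (m * a) q) *
          ball s u (m * a) (q * m) := by simp only [mul_assoc]
      _ = 0 := by rw [h.ball_mul_u_mul_ball_eq_zero hq]; simp
  calc ball s u a q * (star (s k) * (ball s u i N * u n) * s m) * ball s u a q
      = (ball s u a q * star (s k)) * ball s u i N * u n * (s m * ball s u a q) := by
        simp only [mul_assoc]
    _ = star (s k) * (ball s u (k * a) (k * q) * ball s u i N) * u n *
        (ball s u (m * a) (m * q) * s m) := by
        rw [h.ball_mul_star_s, h.s_mul_ball]; simp only [mul_assoc]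
    _ = star (s k) * ball s u i N * (ball s u (k * a) (k * q) * u n *
        ball s u (m * a) (m * q)) * s m := by
        rw [(h.commute_ball _ i _ N).eq]; simp only [mul_assoc]
    _ = 0 := by rw [e]; simp

end Relations

end Ball

/-! ### The core and the elements of nontrivial degree -/

section Core

variable {R : Type u} [CommRing R] {A : Type v} [CStarAlgebra A]

/-- The span of the elements `1_{i+(N)} u^n`, with `N` and `n` fixed. -/
def grade (s : R⁰ → A) (u : R → A) (N : R⁰) (n : Multiplicative R) : Submodule ℂ A :=
  Submodule.span ℂ (Set.range fun i : R => ball s u i N * u n.toAdd)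

/-- The span of the elements `1_{i+(N)} u^n`, with `N` fixed. -/
def stage (s : R⁰ → A) (u : R → A) (N : R⁰) : Submodule ℂ A :=
  ⨆ n, grade s u N n

variable {s : R⁰ → A} {u : R → A}

theorem ball_mul_u_mem_stage (i : R) (N : R⁰) (n : R) : ball s u i N * u n ∈ stage s u N :=
  Submodule.mem_iSup_of_mem (Multiplicative.ofAdd n) (Submodule.subset_span ⟨i, rfl⟩)

theorem stage_induction {N : R⁰} {motive : ∀ x, x ∈ stage s u N → Prop}
    (basic : ∀ i n, motive (ball s u i N * u n) (ball_mul_u_mem_stage i N n))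
    (zero : motive 0 (zero_mem _))
    (add : ∀ x y hx hy, motive x hx → motive y hy → motive (x + y) (add_mem hx hy))
    (smul : ∀ (c : ℂ) x hx, motive x hx → motive (c • x) (Submodule.smul_mem _ c hx))
    {x : A} (hx : x ∈ stage s u N) : motive x hx := by
  suffices ∃ hx, motive x hx from this.2
  induction hx using Submodule.iSup_induction' with
  | mem n x hx =>
    induction hx using Submodule.span_induction with
    | mem x hx => obtain ⟨i, rfl⟩ := hx; exact ⟨_, basic i _⟩
    | zero => exact ⟨_, zero⟩
    | add x y _ _ hx hy => exact ⟨_, add x y _ _ hx.2 hy.2⟩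
    | smul c x _ hx => exact ⟨_, smul c x _ hx.2⟩
  | zero => exact ⟨_, zero⟩
  | add x y _ _ hx hy => exact ⟨_, add x y _ _ hx.2 hy.2⟩

namespace Relations

theorem star_mem_stage (h : Relations Eq s u) {N : R⁰} {x : A} (hx : x ∈ stage s u N) :
    star x ∈ stage s u N := by
  induction hx using stage_induction with
  | basic i n =>
    rw [star_mul, h.star_u, h.star_ball, h.u_mul_ball]
    exact ball_mul_u_mem_stage _ _ _
  | zero => rw [star_zero]; exact zero_mem _
  | add x y _ _ hx hy => rw [star_add]; exact add_mem hx hy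
  | smul c x _ hx => rw [star_smul]; exact Submodule.smul_mem _ _ hx

variable [hfin : ∀ m : R⁰, Finite (R ⧸ Ideal.span {(m : R)})]

theorem mul_mem_grade (h : Relations Eq s u) {N : R⁰} (n n' : Multiplicative R) (x y : A)
    (hx : x ∈ grade s u N n) (hy : y ∈ grade s u N n') : x * y ∈ grade s u N (n * n') := by
  have key : grade s u N n * grade s u N n' ≤ grade s u N (n * n') := by
    rw [grade, grade, Submodule.span_mul_span, Submodule.span_le]
    rintro _ ⟨_, ⟨i, rfl⟩, _, ⟨j, rfl⟩, rfl⟩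
    have e : ball s u i N * u n.toAdd * (ball s u j N * u n'.toAdd) =
        (ball s u i N * ball s u (n.toAdd + j) N) * u (n * n').toAdd := by
      rw [mul_assoc, ← mul_assoc (u _) (ball s u j N), h.u_mul_ball, toAdd_mul, ← h.u_mul_u]
      simp only [mul_assoc]
    change ball s u i N * u n.toAdd * (ball s u j N * u n'.toAdd) ∈ _
    rw [e]
    by_cases hij : (N : R) ∣ i - (n.toAdd + j)
    · rw [h.ball_congr hij, h.ball_mul_self]
      exact Submodule.subset_span ⟨_, rfl⟩
    · rw [h.ball_mul_ball_eq_zero hij, zero_mul]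
      exact zero_mem _
  exact key (Submodule.mul_mem_mul hx hy)

theorem u_mem_grade (h : Relations Eq s u) (N : R⁰)
    (n : Multiplicative R) : u n.toAdd ∈ grade s u N n := by
  have := Fintype.ofFinite (R ⧸ Ideal.span {(N : R)})
  rw [← one_mul (u _), ← h.sum_ball N, Finset.sum_mul]
  exact Submodule.sum_mem _ fun c _ => Submodule.subset_span ⟨_, rfl⟩

theorem u_mem_stage (h : Relations Eq s u) (N : R⁰) (n : R) : u n ∈ stage s u N :=
  Submodule.mem_iSup_of_mem (Multiplicative.ofAdd n) (h.u_mem_grade N (Multiplicative.ofAdd n))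

theorem one_mem_grade (h : Relations Eq s u) (N : R⁰) : 1 ∈ grade s u N 1 := by
  simpa [h.u_zero] using h.u_mem_grade N 1

theorem mul_mem_stage (h : Relations Eq s u) {N : R⁰} {x y : A} (hx : x ∈ stage s u N)
    (hy : y ∈ stage s u N) : x * y ∈ stage s u N := by
  have key : stage s u N * stage s u N ≤ stage s u N := by
    rw [stage, Submodule.iSup_mul]
    refine iSup_le fun n => ?_
    rw [Submodule.mul_iSup]
    refine iSup_le fun n' => ?_
    rw [Submodule.mul_le]
    exact fun x hx y hy => Submodule.mem_iSup_of_mem (n * n') (h.mul_mem_grade _ _ _ _ hx hy)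
  exact key (Submodule.mul_mem_mul hx hy)

theorem stage_le (h : Relations Eq s u) (N M : R⁰) : stage s u N ≤ stage s u (N * M) := by
  intro x hx
  have := Fintype.ofFinite (R ⧸ Ideal.span {(M : R)})
  induction hx using stage_induction with
  | basic i n =>
    rw [h.ball_eq_sum i N M, Finset.sum_mul]
    exact Submodule.sum_mem _ fun c _ => ball_mul_u_mem_stage _ _ _
  | zero => exact zero_mem _
  | add x y _ _ hx hy => exact add_mem hx hy
  | smul c x _ hx => exact Submodule.smul_mem _ _ hx

/-- The `*`-algebra spanned by all `1_{i+(N)} u^n`. -/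
def core (h : Relations Eq s u) : StarSubalgebra ℂ A where
  carrier := {x | ∃ N, x ∈ stage s u N}
  mul_mem' := by
    rintro x y ⟨N, hx⟩ ⟨M, hy⟩
    exact ⟨N * M, h.mul_mem_stage (h.stage_le N M hx) (mul_comm N M ▸ h.stage_le M N hy)⟩
  add_mem' := by
    rintro x y ⟨N, hx⟩ ⟨M, hy⟩
    exact ⟨N * M, add_mem (h.stage_le N M hx) (mul_comm N M ▸ h.stage_le M N hy)⟩
  algebraMap_mem' c := ⟨1, by
    rw [Algebra.algebraMap_eq_smul_one, ← h.u_zero]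
    exact Submodule.smul_mem _ _ (h.u_mem_stage _ _)⟩
  star_mem' := by
    rintro x ⟨N, hx⟩
    exact ⟨N, h.star_mem_stage hx⟩

theorem u_mem_core (h : Relations Eq s u) (n : R) : u n ∈ h.core := ⟨1, h.u_mem_stage 1 n⟩

theorem ball_mem_core (h : Relations Eq s u) (i : R) (N : R⁰) : ball s u i N ∈ h.core :=
  ⟨N, by simpa [h.u_zero] using ball_mul_u_mem_stage (s := s) (u := u) i N 0⟩

theorem range_mem_core (h : Relations Eq s u) (N : R⁰) : s N * star (s N) ∈ h.core :=
  h.ball_zero N ▸ h.ball_mem_core 0 N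

/-- Needed for common denominators: rewriting `m / k` as `ma / ka` conjugates the middle factor by
`s a` (see `expand`). -/
theorem s_conj_mem_core (h : Relations Eq s u) (a : R⁰) {x : A} (hx : x ∈ h.core) :
    s a * x * star (s a) ∈ h.core := by
  obtain ⟨N, hx⟩ := hx
  induction hx using stage_induction with
  | basic i n =>
    rw [← mul_assoc, h.s_mul_ball, mul_assoc (ball s u _ _), h.s_mul_u, mul_assoc, mul_assoc]
    exact mul_mem (h.ball_mem_core _ _) (mul_mem (h.u_mem_core _) (h.range_mem_core a))
  | zero => simp
  | add x y _ _ hx hy => rw [mul_add, add_mul]; exact add_mem hx hy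
  | smul c x _ hx =>
    rw [mul_smul_comm, smul_mul_assoc]; exact (h.core.toSubalgebra.smul_mem hx c)

/-- The span of the elements `s_k^* x s_m` with `x` in the core and `k ≠ m`. -/
def offDiag (h : Relations Eq s u) : Submodule ℂ A :=
  Submodule.span ℂ {w | ∃ k m, k ≠ m ∧ ∃ x ∈ h.core, w = star (s k) * x * s m}

/-- Inserting `star (s k) * s k = 1` on the left moves `c` past `star (s k)` as `s k * c * star (s
k)`, which is again in the core. -/
theorem core_mul_mem_offDiag (h : Relations Eq s u) {c w : A} (hc : c ∈ h.core)
    (hw : w ∈ h.offDiag) : c * w ∈ h.offDiag := by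
  induction hw using Submodule.span_induction with
  | mem w hw =>
    obtain ⟨k, m, hkm, x, hx, rfl⟩ := hw
    refine Submodule.subset_span ⟨k, m, hkm, _, mul_mem (h.s_conj_mem_core k hc) hx, ?_⟩
    calc c * (star (s k) * x * s m) = (star (s k) * s k) * (c * (star (s k) * x * s m)) := by
          rw [h.isometry, one_mul]
      _ = _ := by simp only [mul_assoc]
  | zero => simp
  | add x y _ _ hx hy => rw [mul_add]; exact add_mem hx hy
  | smul c x _ hx => rw [mul_smul_comm]; exact Submodule.smul_mem _ _ hx

theorem star_mem_offDiag (h : Relations Eq s u) {w : A} (hw : w ∈ h.offDiag) :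
    star w ∈ h.offDiag := by
  induction hw using Submodule.span_induction with
  | mem w hw =>
    obtain ⟨k, m, hkm, x, hx, rfl⟩ := hw
    exact Submodule.subset_span ⟨m, k, hkm.symm, star x, star_mem hx, by simp [mul_assoc]⟩
  | zero => simp
  | add x y _ _ hx hy => rw [star_add]; exact add_mem hx hy
  | smul c x _ hx => rw [star_smul]; exact Submodule.smul_mem _ _ hx

theorem mul_core_mem_offDiag (h : Relations Eq s u) {c w : A} (hc : c ∈ h.core)
    (hw : w ∈ h.offDiag) : w * c ∈ h.offDiag := by
  simpa using h.star_mem_offDiag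
    (h.core_mul_mem_offDiag (star_mem hc) (h.star_mem_offDiag hw))

end Relations

/-- The span of the elements `s_k^* 1_{i+(N)} u^n s_m` acting by a nontrivial affine map. -/
def nontrivialPart (s : R⁰ → A) (u : R → A) : Submodule ℂ A :=
  Submodule.span ℂ {w | ∃ (k m N : R⁰) (i n : R), (k ≠ m ∨ n ≠ 0) ∧
    w = star (s k) * (ball s u i N * u n) * s m}

namespace Relations

theorem ball_mul_u_mem_nontrivialPart (h : Relations Eq s u) (i : R) (N : R⁰) {n : R}
    (hn : n ≠ 0) : ball s u i N * u n ∈ nontrivialPart s u :=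
  Submodule.subset_span ⟨1, 1, N, i, n, Or.inr hn, by simp [h.s_one]⟩

variable [hfin : ∀ m : R⁰, Finite (R ⧸ Ideal.span {(m : R)})]

theorem offDiag_le (h : Relations Eq s u) : h.offDiag ≤ nontrivialPart s u := by
  refine Submodule.span_le.2 ?_
  rintro _ ⟨k, m, hkm, x, ⟨N, hx⟩, rfl⟩
  induction hx using stage_induction with
  | basic i n => exact Submodule.subset_span ⟨k, m, N, i, n, Or.inl hkm, rfl⟩
  | zero => simp
  | add x y _ _ hx hy => rw [mul_add, add_mul]; exact add_mem hx hy
  | smul c x _ hx => rw [mul_smul_comm, smul_mul_assoc]; exact Submodule.smul_mem _ _ hx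

/-- Finitely many elements of nontrivial degree are cut to zero by a ball inside a given ball. -/
theorem exists_ball_mul_mul_ball_eq_zero [IsDomain R] (hfield : ¬ IsField R)
    (h : Relations Eq s u) (c : R) (N : R⁰) {T : Set A} (hT : T.Finite)
    (hTV : T ⊆ nontrivialPart s u) :
    ∃ a q, ball s u a q * ball s u c N = ball s u a q ∧
      ∀ w ∈ T, ball s u a q * w * ball s u a q = 0 := by
  classical
  have hinf : Infinite R := not_finite_iff_infinite.1 fun hf => hfield (Finite.isField_of_domain R)
  -- Each generator gets its displacement `f a = k a - (n + m a)`. Along `a = c + N t` this is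
  -- affine in `t` with at most one root: its slope `(k - m) N` is nonzero, or else it is the
  -- nonzero constant `-n`.
  have gen : ∀ w ∈ {w | ∃ (k m N : R⁰) (i n : R), (k ≠ m ∨ n ≠ 0) ∧
      w = star (s k) * (ball s u i N * u n) * s m}, ∃ f : R → R,
      {t : R | f (c + N * t) = 0}.Finite ∧
      ∀ (a : R) (q : R⁰), ¬ (q : R) ∣ f a → ball s u a q * w * ball s u a q = 0 := by
    rintro _ ⟨k, m, M, i, n, hne, rfl⟩
    refine ⟨fun a => k * a - (n + m * a), Set.Subsingleton.finite ?_,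
      fun a q hq => h.ball_mul_mul_ball_eq_zero i M hq⟩
    intro t ht t' ht'
    simp only [Set.mem_ofPred_eq] at ht ht'
    have e : ((k : R) - m) * (N * (t - t')) = 0 := by linear_combination ht - ht'
    have hN : (N : R) ≠ 0 := nonZeroDivisors.coe_ne_zero N
    rcases mul_eq_zero.1 e with e | e
    · have hkm : k = m := Subtype.ext (sub_eq_zero.1 e)
      subst hkm
      refine absurd ?_ (hne.resolve_left fun hh => hh rfl)
      linear_combination -ht
    · exact sub_eq_zero.1 ((mul_eq_zero.1 e).resolve_left hN)
  choose! f hf1 hf2 using gen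
  have hspan : ∀ w ∈ T, ∃ S : Finset A, (S : Set A) ⊆ {w | ∃ (k m N : R⁰) (i n : R),
      (k ≠ m ∨ n ≠ 0) ∧ w = star (s k) * (ball s u i N * u n) * s m} ∧
      w ∈ Submodule.span ℂ (S : Set A) := fun w hw =>
    Submodule.mem_span_finite_of_mem_span (hTV hw)
  choose! S hS1 hS2 using hspan
  let S' : Finset A := hT.toFinset.biUnion S
  have hS' : ∀ x ∈ S', ∃ (k m N : R⁰) (i n : R),
      (k ≠ m ∨ n ≠ 0) ∧ x = star (s k) * (ball s u i N * u n) * s m := fun x hx => by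
    obtain ⟨w, hw, hx⟩ := Finset.mem_biUnion.1 hx
    exact hS1 w (hT.mem_toFinset.1 hw) hx
  have hfinite : (⋃ x ∈ S', {t : R | f x (c + N * t) = 0}).Finite :=
    S'.finite_toSet.biUnion fun x hx => hf1 x (hS' x hx)
  -- `R` is infinite, so some centre `c + N t` is moved by all the finitely many generators
  -- involved.
  obtain ⟨t, ht⟩ := hfinite.exists_notMem
  simp only [Set.mem_iUnion, Set.mem_ofPred_eq, not_exists] at ht
  obtain ⟨r, hr0, hr⟩ := Ring.not_isField_iff_exists_ideal_bot_lt_and_lt_top.1 hfield |>.elim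
    fun I hI => by
      obtain ⟨r, hrI, hr0⟩ := Submodule.exists_mem_ne_zero_of_ne_bot hI.1.ne'
      exact (⟨r, hr0, fun hu => hI.2.ne (Ideal.eq_top_of_isUnit_mem _ hrI hu)⟩ :
        ∃ r : R, r ≠ 0 ∧ ¬ IsUnit r)
  -- `P` is a multiple of every displacement with the nonunit `r` as an extra factor, so `N * P`
  -- divides none of them: cancelling the displacement would make `r` a unit.
  let P : R⁰ := ⟨r * ∏ x ∈ S', f x (c + N * t), mem_nonZeroDivisors_of_ne_zero
    (mul_ne_zero hr0 (Finset.prod_ne_zero_iff.2 fun x hx => ht x hx))⟩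
  refine ⟨c + N * t, N * P, ?_, fun w hw => ?_⟩
  · rw [← h.ball_congr (show (N : R) ∣ (c + N * t) - c from ⟨t, by ring⟩),
      h.ball_mul_ball_nested]
  · have key : ∀ x ∈ S', ball s u (c + N * t) (N * P) * x * ball s u (c + N * t) (N * P) = 0 := by
      intro x hx
      refine hf2 x (hS' x hx) _ _ fun hdvd => hr ?_
      obtain ⟨b, hb⟩ := Finset.dvd_prod_of_mem (fun x => f x (c + N * t)) hx
      obtain ⟨d, hd⟩ := hdvd
      refine IsUnit.of_mul_eq_one (N * b * d) (mul_left_cancel₀ (ht x hx) ?_)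
      have hP : ((N * P : R⁰) : R) = N * (r * (f x (c + N * t) * b)) := by
        rw [← hb]; rfl
      rw [hP] at hd
      linear_combination -hd
    have hw2 : w ∈ Submodule.span ℂ (S' : Set A) :=
      Submodule.span_mono (fun x hx => Finset.mem_biUnion.2 ⟨w, hT.mem_toFinset.2 hw, hx⟩)
        (hS2 w hw)
    clear hw
    induction hw2 using Submodule.span_induction with
    | mem x hx => exact key x hx
    | zero => simp
    | add x y _ _ hx hy => rw [mul_add, add_mul, hx, hy, add_zero]
    | smul c x _ hx => rw [mul_smul_comm, smul_mul_assoc, hx, smul_zero]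

end Relations
end Core

/-! ### Norm estimates -/

section Estimates

variable {R : Type u} [CommRing R] {B : Type*} [CStarAlgebra B] {A : Type v} [CStarAlgebra A]
  {s : R⁰ → B} {u : R → B}

namespace Relations

theorem norm_s_le [Nontrivial B] (h : Relations Eq s u) (m : R⁰) : ‖s m‖ ≤ 1 := by
  have e := CStarRing.norm_star_mul_self (x := s m)
  rw [h.isometry, norm_one] at e
  nlinarith [norm_nonneg (s m)]

theorem norm_u_le [Nontrivial B] (h : Relations Eq s u) (n : R) : ‖u n‖ ≤ 1 := by
  have e := CStarRing.norm_star_mul_self (x := u n)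
  rw [h.unitary_left, norm_one] at e
  nlinarith [norm_nonneg (u n)]

theorem norm_ball_le [Nontrivial B] (h : Relations Eq s u) (i : R) (N : R⁰) :
    ‖ball s u i N‖ ≤ 1 := by
  have e := CStarRing.norm_star_mul_self (x := ball s u i N)
  rw [h.star_ball, h.ball_mul_self] at e
  nlinarith [norm_nonneg (ball s u i N)]

/-- `1` has the form `y * ball * z`, so `π` cannot send the projection to zero; a nonzero projection
has norm one. -/
theorem norm_map_ball [Nontrivial A] (h : Relations Eq s u) (π : B →⋆ₐ[ℂ] A) (i : R) (N : R⁰) :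
    ‖π (ball s u i N)‖ = 1 := by
  have e := CStarRing.norm_star_mul_self (x := π (ball s u i N))
  rw [← map_star, ← map_mul, h.star_ball, h.ball_mul_self] at e
  refine mul_left_cancel₀ (fun h0 => ?_) (e.symm.trans (mul_one _).symm)
  rw [norm_eq_zero] at h0
  have e1 : star (s N) * u (-i) * ball s u i N * (u i * s N) = 1 := by
    calc _ = star (s N) * (u (-i) * u i) * (s N * star (s N)) * (u (-i) * u i) * s N := by
          simp only [ball, mul_assoc]
      _ = (star (s N) * s N) * (star (s N) * s N) := by
          rw [h.u_neg_mul]; simp only [mul_one, mul_assoc]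
      _ = 1 := by rw [h.isometry, one_mul]
  have e2 := congrArg π e1
  rw [map_mul, map_mul, h0, map_one] at e2
  simp at e2

/-- With `v = b * u (-n) * p`, the hypothesis says that `x * v` and `w * v` have orthogonal ranges,
so adding `w` cannot decrease the norm of `π (x * v)`. -/
theorem norm_map_le_of_cross_eq_zero (h : Relations Eq s u) (π : B →⋆ₐ[ℂ] A) {p x w b : B} {n : R}
    (hp : star p = p) (hcross : p * (u n * (star b * star x * w * b) * u (-n)) * p = 0) :
    ‖π (x * (b * (u (-n) * p)))‖ ≤ ‖π (x + w)‖ * ‖π (b * (u (-n) * p))‖ := by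
  have e : star (π (x * (b * (u (-n) * p)))) * π (w * (b * (u (-n) * p))) = 0 := by
    rw [← map_star, ← map_mul]
    convert map_zero π
    rw [← hcross]
    simp only [star_mul, h.star_u, hp, neg_neg, mul_assoc]
  refine (norm_le_norm_add_of_star_mul_eq_zero e).trans ?_
  rw [← map_add, ← add_mul, map_mul]
  exact norm_mul_le _ _

/-- Distinct cosets of `(N)` are orthogonal, so cutting to one coset leaves a single coefficient. -/
theorem exists_ball_mul_eq_smul [hfin : ∀ m : R⁰, Finite (R ⧸ Ideal.span {(m : R)})]
    (h : Relations Eq s u) {N : R⁰} {n : Multiplicative R} {x : B} (hx : x ∈ grade s u N n)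
    (c : R) : ∃ l : ℂ, ball s u c N * x = l • (ball s u c N * u n.toAdd) := by
  induction hx using Submodule.span_induction with
  | mem x hx =>
    obtain ⟨i, rfl⟩ := hx
    by_cases hc : (N : R) ∣ c - i
    · exact ⟨1, by simp only [← h.ball_congr hc, ← mul_assoc, h.ball_mul_self, one_smul]⟩
    · exact ⟨0, by simp only [← mul_assoc, h.ball_mul_ball_eq_zero hc, zero_mul, zero_smul]⟩
  | zero => exact ⟨0, by simp⟩
  | add x y _ _ hx hy =>
    obtain ⟨l, hl⟩ := hx
    obtain ⟨l', hl'⟩ := hy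
    exact ⟨l + l', by rw [mul_add, hl, hl', add_smul]⟩
  | smul a x _ hx =>
    obtain ⟨l, hl⟩ := hx
    exact ⟨a * l, by rw [mul_smul_comm, hl, smul_smul]⟩

variable [IsDomain R] [hfin : ∀ m : R⁰, Finite (R ⧸ Ideal.span {(m : R)})]

/-- The left side is at most the modulus of one coefficient `l`. A small ball `p` inside `c + (N)`
isolates it: `p (x^* x)^k u^{-n} p = l p`. The same `p` makes `w` invisible, so each factor `x` or
`x^*` costs at most `‖π (x + w)‖`. -/
theorem norm_component_le [Nontrivial A] (hfield : ¬ IsField R) (h : Relations Eq s u)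
    (π : B →⋆ₐ[ℂ] A) {x w : B} (hx : x ∈ h.core) (hw : w ∈ h.offDiag) {N : R⁰} {k : ℕ}
    {F : Finset (Multiplicative R)} {z : Multiplicative R → B} (hz : ∀ g, z g ∈ grade s u N g)
    (hk : (star x * x) ^ k = ∑ g ∈ F, z g) {g : Multiplicative R} (hg : g ∈ F) (c : R) :
    ‖ball s u c N * z g‖ ≤ (‖π (x + w)‖ ^ 2) ^ k := by
  classical
  have _ : Nontrivial B := π.toRingHom.domain_nontrivial
  set n : R := g.toAdd with hn
  -- `p` must kill the components of degree other than `g` (`T₁`) and the cross terms arising when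
  -- the factors `x` (`T₂`) and `star x` (`T₃`) are applied in turn.
  let T₁ : Set B := (fun g' => ball s u c N * z g' * u (-n)) '' (F.erase g : Set _)
  let T₂ : Set B := (fun j : ℕ => u n * (star ((star x * x) ^ j) * star x * w *
    (star x * x) ^ j) * u (-n)) '' (Finset.range k : Set ℕ)
  let T₃ : Set B := (fun j : ℕ => u n * (star (x * (star x * x) ^ j) * star (star x) * star w *
    (x * (star x * x) ^ j)) * u (-n)) '' (Finset.range k : Set ℕ)
  have hT : (T₁ ∪ T₂ ∪ T₃).Finite :=
    (((Finset.finite_toSet _).image _).union ((Finset.finite_toSet _).image _)).union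
      ((Finset.finite_toSet _).image _)
  have hpow : ∀ j, (star x * x) ^ j ∈ h.core := fun j => pow_mem (mul_mem (star_mem hx) hx) j
  have hTV : T₁ ∪ T₂ ∪ T₃ ⊆ nontrivialPart s u := by
    rintro _ ((⟨g', hg', rfl⟩ | ⟨j, -, rfl⟩) | ⟨j, -, rfl⟩)
    · obtain ⟨l, hl⟩ := h.exists_ball_mul_eq_smul (hz g') c
      change ball s u c N * z g' * u (-n) ∈ _
      rw [hl, smul_mul_assoc, mul_assoc, h.u_mul_u]
      refine Submodule.smul_mem _ _ (h.ball_mul_u_mem_nontrivialPart _ _ fun h0 => ?_)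
      exact (Finset.mem_erase.1 hg').1 (Multiplicative.toAdd.injective (add_neg_eq_zero.1 h0))
    · exact h.offDiag_le (h.mul_core_mem_offDiag (h.u_mem_core _) (h.core_mul_mem_offDiag
        (h.u_mem_core _) (h.mul_core_mem_offDiag (hpow j) (h.core_mul_mem_offDiag
        (mul_mem (star_mem (hpow j)) (star_mem hx)) hw))))
    · exact h.offDiag_le (h.mul_core_mem_offDiag (h.u_mem_core _) (h.core_mul_mem_offDiag
        (h.u_mem_core _) (h.mul_core_mem_offDiag (mul_mem hx (hpow j)) (h.core_mul_mem_offDiag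
        (mul_mem (star_mem (mul_mem hx (hpow j))) (star_mem (star_mem hx)))
        (h.star_mem_offDiag hw)))))
  obtain ⟨a, q, hnest, hkill⟩ :=
    h.exists_ball_mul_mul_ball_eq_zero hfield c N hT hTV
  set p := ball s u a q with hp
  have hstep : ∀ j ≤ k, ‖π ((star x * x) ^ j * (u (-n) * p))‖ ≤ (‖π (x + w)‖ ^ 2) ^ j := by
    intro j hj
    induction j with
    | zero =>
      rw [pow_zero, pow_zero, one_mul]
      refine (NonUnitalStarAlgHom.norm_apply_le π _).trans ((norm_mul_le _ _).trans ?_)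
      exact mul_le_one₀ (h.norm_u_le _) (norm_nonneg _) (h.norm_ball_le _ _)
    | succ j ih =>
      have hjk : j ∈ (Finset.range k : Set ℕ) := by simpa using hj
      have i1 := h.norm_map_le_of_cross_eq_zero π (h.star_ball a q)
        (hkill _ (Or.inl (Or.inr ⟨j, hjk, rfl⟩)))
      have i2 := h.norm_map_le_of_cross_eq_zero π (h.star_ball a q)
        (hkill _ (Or.inr ⟨j, hjk, rfl⟩))
      -- For the factor `star x` the perturbation is `star w`, so the cost is again `‖π (x + w)‖`.
      rw [← star_add, map_star, norm_star] at i2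
      rw [pow_succ', mul_assoc, mul_assoc]
      rw [mul_assoc x] at i2
      have i3 := ih (by omega)
      calc _ ≤ _ := i2
        _ ≤ ‖π (x + w)‖ * (‖π (x + w)‖ * (‖π (x + w)‖ ^ 2) ^ j) := by
            gcongr
            exact i1.trans (by gcongr)
        _ = _ := by ring
  obtain ⟨l, hl⟩ := h.exists_ball_mul_eq_smul (hz g) c
  have e : p * ((star x * x) ^ k * (u (-n) * p)) = l • p := by
    rw [hk, Finset.sum_mul, Finset.mul_sum, Finset.sum_eq_single_of_mem g hg]
    · calc p * (z g * (u (-n) * p)) = p * (ball s u c N * z g) * (u (-n) * p) := by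
            rw [← mul_assoc p (ball s u c N), hnest, mul_assoc]
        _ = l • ((p * ball s u c N) * (u n * u (-n)) * p) := by
            rw [hl, mul_smul_comm, smul_mul_assoc]; simp only [mul_assoc, hn]
        _ = l • p := by rw [hnest, h.u_mul_neg, mul_one, h.ball_mul_self]
    · intro g' hg' hne
      have := hkill _ (Or.inl (Or.inl ⟨g', by simp [hg', hne], rfl⟩))
      calc p * (z g' * (u (-n) * p)) = (p * ball s u c N) * z g' * u (-n) * p := by
            rw [hnest]; simp only [mul_assoc]
        _ = 0 := by rw [← this]; simp only [mul_assoc]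
  calc ‖ball s u c N * z g‖ ≤ ‖l‖ := by
        rw [hl, norm_smul]
        exact mul_le_of_le_one_right (norm_nonneg _) ((norm_mul_le _ _).trans
          (mul_le_one₀ (h.norm_ball_le _ _) (norm_nonneg _) (h.norm_u_le _)))
    _ = ‖π (l • p)‖ := by rw [map_smul, norm_smul, h.norm_map_ball π, mul_one]
    _ ≤ 1 * ‖π ((star x * x) ^ k * (u (-n) * p))‖ := by
        rw [← e, map_mul, ← h.norm_map_ball π a q]
        exact norm_mul_le _ _
    _ ≤ _ := by rw [one_mul]; exact hstep k le_rfl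

/-- Each component is the sum of its cuts to the cosets of `(N)`, so growth applies with `C` the
number of cosets, which does not depend on `k`. -/
theorem norm_core_le [Nontrivial A] (hfield : ¬ IsField R) (h : Relations Eq s u)
    (π : B →⋆ₐ[ℂ] A) {x w : B} (hx : x ∈ h.core) (hw : w ∈ h.offDiag) :
    ‖x‖ ≤ ‖π (x + w)‖ := by
  obtain ⟨N, hN⟩ := mul_mem (star_mem hx) hx
  have := Fintype.ofFinite (R ⧸ Ideal.span {(N : R)})
  have key : ‖star x * x‖ ≤ ‖π (x + w)‖ ^ 2 := by
    refine norm_le_of_graded (ℬ := grade s u N) (h.one_mem_grade N) h.mul_mem_grade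
      (IsSelfAdjoint.star_mul_self x) hN (C := Fintype.card (R ⧸ Ideal.span {(N : R)}))
      (by positivity) fun k F z hz hk g hg => ?_
    rw [← one_mul (z g), ← h.sum_ball N, Finset.sum_mul]
    refine (norm_sum_le_of_le _ fun c _ =>
      h.norm_component_le hfield π hx hw hz hk hg c.out).trans ?_
    rw [Finset.sum_const, nsmul_eq_mul, Finset.card_univ]
  rw [CStarRing.norm_star_mul_self, ← sq] at key
  exact (pow_le_pow_iff_left₀ (norm_nonneg _) (norm_nonneg _) two_ne_zero).1 key

end Relations
end Estimates

/-! ### The grading by the fraction field -/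

section Homog

variable {R : Type u} [CommRing R] {B : Type*} [CStarAlgebra B] {s : R⁰ → B} {u : R → B}

namespace Relations

theorem expand (h : Relations Eq s u) (k m a : R⁰) (x : B) :
    star (s k) * x * s m = star (s (k * a)) * (s a * x * star (s a)) * s (m * a) := by
  rw [← h.s_mul_s, h.s_comm k, ← h.s_mul_s, h.s_comm m, star_mul]
  calc star (s k) * x * s m = star (s k) * (star (s a) * s a) * x * (star (s a) * s a) * s m := by
        rw [h.isometry, mul_one, mul_one]
    _ = _ := by simp only [mul_assoc]

theorem s_mul_star_s (h : Relations Eq s u) (m k : R⁰) :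
    s m * star (s k) = star (s k) * s m * (s k * star (s k)) := by
  calc s m * star (s k) = (star (s k) * s k) * (s m * star (s k)) := by rw [h.isometry, one_mul]
    _ = star (s k) * (s k * s m) * star (s k) := by simp only [mul_assoc]
    _ = _ := by rw [h.s_comm]; simp only [mul_assoc]

/-- The inner `s m * star (s k')` is reordered by `s_mul_star_s`, giving the product fraction `(m
m') / (k k')`. -/
theorem mul_basic (h : Relations Eq s u) (k m k' m' : R⁰) (x x' : B) :
    (star (s k) * x * s m) * (star (s k') * x' * s m') =
      star (s (k * k')) * ((s k' * x * star (s k')) *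
        (s m * ((s k' * star (s k')) * x') * star (s m))) * s (m * m') := by
  symm
  rw [← h.s_mul_s m, ← h.s_mul_s k, h.s_comm k, star_mul]
  calc _ = star (s k) * (star (s k') * s k') * x * (star (s k') * s m * (s k' * star (s k'))) *
        x' * (star (s m) * s m) * s m' := by simp only [mul_assoc]
    _ = _ := by
        rw [h.isometry, h.isometry, ← h.s_mul_star_s]; simp only [mul_one, mul_assoc]

variable [hfin : ∀ m : R⁰, Finite (R ⧸ Ideal.span {(m : R)})]

/-- The elements of degree `g` in the fraction field: `s_k^* x s_m` with `m = g k`, `x` in the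
core. -/
def homog (h : Relations Eq s u) (g : FractionRing R) : Submodule ℂ B :=
  Submodule.span ℂ {y | ∃ k m : R⁰,
    algebraMap R (FractionRing R) m = g * algebraMap R (FractionRing R) k ∧
    ∃ x ∈ h.core, y = star (s k) * x * s m}

/-- Elements of equal degree acquire the common denominator `k * k'`, and then their numerators `m *
k'` and `m' * k` agree. The case `y = 0` covers `g = 0`, for which no pair `k`, `m` exists. -/
theorem eq_basic_of_mem_homog (h : Relations Eq s u) {g : FractionRing R} {y : B}
    (hy : y ∈ h.homog g) : y = 0 ∨ ∃ k m : R⁰,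
      algebraMap R (FractionRing R) m = g * algebraMap R (FractionRing R) k ∧
      ∃ x ∈ h.core, y = star (s k) * x * s m := by
  induction hy using Submodule.span_induction with
  | mem y hy => exact Or.inr hy
  | zero => exact Or.inl rfl
  | add y y' _ _ hy hy' =>
    rcases hy with rfl | ⟨k, m, hkm, x, hx, rfl⟩
    · rwa [zero_add]
    rcases hy' with rfl | ⟨k', m', hkm', x', hx', rfl⟩
    · rw [add_zero]; exact Or.inr ⟨k, m, hkm, x, hx, rfl⟩
    refine Or.inr ⟨k * k', m * k', ?_, _,
      add_mem (h.s_conj_mem_core k' hx) (h.s_conj_mem_core k hx'), ?_⟩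
    · simp only [Submonoid.coe_mul, map_mul, hkm, mul_assoc]
    · have e : m * k' = m' * k := by
        refine Subtype.ext (IsFractionRing.injective R (FractionRing R) ?_)
        simp only [Submonoid.coe_mul, map_mul, hkm, hkm']
        ring
      rw [h.expand k m k', h.expand k' m' k, mul_comm k' k, ← e]
      rw [mul_add, add_mul]
  | smul c y _ hy =>
    rcases hy with rfl | ⟨k, m, hkm, x, hx, rfl⟩
    · exact Or.inl (smul_zero c)
    · exact Or.inr ⟨k, m, hkm, c • x, h.core.toSubalgebra.smul_mem hx c, by
        rw [mul_smul_comm, smul_mul_assoc]⟩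

theorem basic_mem_homog (h : Relations Eq s u) {g : FractionRing R} {k m : R⁰} {x : B}
    (hkm : algebraMap R (FractionRing R) m = g * algebraMap R (FractionRing R) k)
    (hx : x ∈ h.core) : star (s k) * x * s m ∈ h.homog g :=
  Submodule.subset_span ⟨k, m, hkm, x, hx, rfl⟩

theorem core_le_homog (h : Relations Eq s u) {x : B} (hx : x ∈ h.core) : x ∈ h.homog 1 := by
  simpa [h.s_one] using h.basic_mem_homog (g := 1) (k := 1) (m := 1) (by simp) hx

theorem s_mem_homog (h : Relations Eq s u) (m : R⁰) :
    s m ∈ h.homog (algebraMap R (FractionRing R) m) := by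
  simpa [h.s_one] using h.basic_mem_homog (k := 1) (m := m) (by simp) (one_mem h.core)

theorem star_s_mem_homog [IsDomain R] (h : Relations Eq s u) (m : R⁰) :
    star (s m) ∈ h.homog (algebraMap R (FractionRing R) m)⁻¹ := by
  simpa [h.s_one] using h.basic_mem_homog (k := m) (m := 1) (by
    rw [inv_mul_cancel₀, Submonoid.coe_one, map_one]
    simp) (one_mem h.core)

theorem mul_mem_homog (h : Relations Eq s u) (g g' : FractionRing R) (y y' : B)
    (hy : y ∈ h.homog g) (hy' : y' ∈ h.homog g') : y * y' ∈ h.homog (g * g') := by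
  rcases h.eq_basic_of_mem_homog hy with rfl | ⟨k, m, hkm, x, hx, rfl⟩
  · simp
  rcases h.eq_basic_of_mem_homog hy' with rfl | ⟨k', m', hkm', x', hx', rfl⟩
  · simp
  rw [h.mul_basic]
  refine h.basic_mem_homog ?_ (mul_mem (h.s_conj_mem_core _ hx)
    (h.s_conj_mem_core _ (mul_mem (h.range_mem_core _) hx')))
  simp only [Submonoid.coe_mul, map_mul, hkm, hkm']
  ring

theorem star_mem_homog [IsDomain R] (h : Relations Eq s u) {g : FractionRing R} {y : B}
    (hy : y ∈ h.homog g) : star y ∈ h.homog g⁻¹ := by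
  rcases h.eq_basic_of_mem_homog hy with rfl | ⟨k, m, hkm, x, hx, rfl⟩
  · simp
  have e : star (star (s k) * x * s m) = star (s m) * star x * s k := by simp [mul_assoc]
  rw [e]
  refine h.basic_mem_homog ?_ (star_mem hx)
  have hm : algebraMap R (FractionRing R) m ≠ 0 := by
    simp
  have hg : g ≠ 0 := by rintro rfl; simp at hkm
  rw [hkm, inv_mul_cancel_left₀ hg]

theorem homog_le_offDiag (h : Relations Eq s u) {g : FractionRing R} (hg : g ≠ 1) :
    h.homog g ≤ h.offDiag := by
  intro y hy
  rcases h.eq_basic_of_mem_homog hy with rfl | ⟨k, m, hkm, x, hx, rfl⟩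
  · exact zero_mem _
  refine Submodule.subset_span ⟨k, m, ?_, x, hx, rfl⟩
  rintro rfl
  refine hg ?_
  have hu := IsLocalization.map_units (FractionRing R) k
  exact (hu.mul_right_cancel (by rw [one_mul, ← hkm]))

/-- The span of all homogeneous elements. -/
def homogSpan (h : Relations Eq s u) : Submodule ℂ B := ⨆ g, h.homog g

theorem mul_mem_homogSpan (h : Relations Eq s u) {x y : B} (hx : x ∈ h.homogSpan)
    (hy : y ∈ h.homogSpan) : x * y ∈ h.homogSpan := by
  have key : h.homogSpan * h.homogSpan ≤ h.homogSpan := by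
    rw [homogSpan, Submodule.iSup_mul]
    refine iSup_le fun n => ?_
    rw [Submodule.mul_iSup]
    refine iSup_le fun n' => ?_
    rw [Submodule.mul_le]
    exact fun x hx y hy => Submodule.mem_iSup_of_mem (n * n') (h.mul_mem_homog _ _ _ _ hx hy)
  exact key (Submodule.mul_mem_mul hx hy)

theorem star_mem_homogSpan [IsDomain R] (h : Relations Eq s u) {x : B} (hx : x ∈ h.homogSpan) :
    star x ∈ h.homogSpan := by
  induction hx using Submodule.iSup_induction' with
  | mem g x hx => exact Submodule.mem_iSup_of_mem g⁻¹ (h.star_mem_homog hx)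
  | zero => simp
  | add x y _ _ hx hy => rw [star_add]; exact add_mem hx hy

variable [IsDomain R]

/-- The `*`-algebra spanned by all homogeneous elements. -/
def homogAlg (h : Relations Eq s u) : StarSubalgebra ℂ B where
  carrier := h.homogSpan
  mul_mem' := h.mul_mem_homogSpan
  add_mem' := add_mem
  algebraMap_mem' c := Submodule.mem_iSup_of_mem 1 (h.core_le_homog (h.core.algebraMap_mem c))
  star_mem' := h.star_mem_homogSpan

/-- For `g = m / k`, the map `y ↦ s k * y * star (s m)` puts the component of degree `g` in the core
and the others off the diagonal, where `norm_core_le` applies; it is undone by `star (s k)` and `s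
m`, all of norm at most one. -/
theorem norm_homog_component_le {A : Type v} [CStarAlgebra A] [Nontrivial A]
    (hfield : ¬ IsField R) (h : Relations Eq s u) (π : B →⋆ₐ[ℂ] A) {F : Finset (FractionRing R)}
    {z : FractionRing R → B} (hz : ∀ g, z g ∈ h.homog g) {g : FractionRing R} (hg : g ∈ F) :
    ‖z g‖ ≤ ‖π (∑ g ∈ F, z g)‖ := by
  classical
  have _ : Nontrivial B := π.toRingHom.domain_nontrivial
  rcases h.eq_basic_of_mem_homog (hz g) with h0 | ⟨k, m, hkm, x, hx, e⟩
  · rw [h0, norm_zero]; exact norm_nonneg _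
  have hks := h.norm_s_le k
  have hms := h.norm_s_le m
  have hne : ∀ m : R⁰, algebraMap R (FractionRing R) m ≠ 0 := fun m => by
    simp
  have hX : s k * z g * star (s m) ∈ h.core := by
    have : s k * z g * star (s m) = (s k * star (s k)) * x * (s m * star (s m)) := by
      rw [e]; simp only [mul_assoc]
    rw [this]
    exact mul_mem (mul_mem (h.range_mem_core k) hx) (h.range_mem_core m)
  have hW : ∑ g' ∈ F.erase g, s k * z g' * star (s m) ∈ h.offDiag := by
    refine Submodule.sum_mem _ fun g' hg' => h.homog_le_offDiag ?_
      (h.mul_mem_homog _ _ _ _ (h.mul_mem_homog _ _ _ _ (h.s_mem_homog k) (hz g'))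
        (h.star_s_mem_homog m))
    -- The new degree is `k g' / m`; if it equals `1`, then `m = g k` forces `g' = g`.
    intro h1
    refine (Finset.mem_erase.1 hg').1 (mul_right_cancel₀ (hne k) ?_)
    rw [← hkm, mul_comm]
    exact (mul_inv_eq_one₀ (hne m)).1 h1
  have key := h.norm_core_le hfield π hX hW
  rw [Finset.add_sum_erase F (fun g => s k * z g * star (s m)) hg, ← Finset.sum_mul,
    ← Finset.mul_sum, map_mul, map_mul] at key
  have e2 : z g = star (s k) * (s k * z g * star (s m)) * s m := by
    calc z g = (star (s k) * s k) * z g * (star (s m) * s m) := by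
          rw [h.isometry, h.isometry, one_mul, mul_one]
      _ = _ := by simp only [mul_assoc]
  have hπ : ∀ x : B, ‖π x‖ ≤ ‖x‖ := fun x => NonUnitalStarAlgHom.norm_apply_le π x
  calc ‖z g‖ ≤ ‖star (s k)‖ * ‖s k * z g * star (s m)‖ * ‖s m‖ := by
        conv_lhs => rw [e2]
        exact norm_mul₃_le
    _ ≤ 1 * ‖s k * z g * star (s m)‖ * 1 := by rw [norm_star]; gcongr
    _ ≤ ‖π (s k)‖ * ‖π (∑ g ∈ F, z g)‖ * ‖π (star (s m))‖ := by
        rw [one_mul, mul_one]; exact key.trans norm_mul₃_le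
    _ ≤ 1 * ‖π (∑ g ∈ F, z g)‖ * 1 := by
        gcongr
        · exact (hπ _).trans hks
        · exact (hπ _).trans ((norm_star _).le.trans hms)
    _ = _ := by rw [one_mul, mul_one]

theorem norm_le_norm_map {A : Type v} [CStarAlgebra A] [Nontrivial A]
    (hfield : ¬ IsField R) (h : Relations Eq s u) (π : B →⋆ₐ[ℂ] A) {y : B}
    (hy : y ∈ h.homogSpan) : ‖y‖ ≤ ‖π y‖ := by
  have key : ‖star y * y‖ ≤ ‖π y‖ ^ 2 := by
    refine norm_le_of_graded (ℬ := h.homog) (h.core_le_homog (one_mem _)) h.mul_mem_homog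
      (IsSelfAdjoint.star_mul_self y) (h.mul_mem_homogSpan (h.star_mem_homogSpan hy) hy) (C := 1)
      (by positivity) fun k F z hz hk g hg => ?_
    refine (h.norm_homog_component_le hfield π hz hg).trans ?_
    rw [← hk, map_pow, one_mul, sq, ← CStarRing.norm_star_mul_self, ← map_star, ← map_mul]
    exact norm_pow_le _ _
  rw [CStarRing.norm_star_mul_self, ← sq] at key
  exact (pow_le_pow_iff_left₀ (norm_nonneg _) (norm_nonneg _) two_ne_zero).1 key

end Relations
end Homog

/-! ### Homomorphisms from the universal algebra -/

namespace UnivAlg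

variable {R : Type u} [CommRing R]

theorem coe_mem (S : StarSubalgebra ℂ (UnivAlg R)) (hs : ∀ m, s m ∈ S) (hu : ∀ n, u n ∈ S)
    (x : FreeStarAlg R) : coe R x ∈ S := by
  have h3 : ∀ y, coe R (FreeStarAlg.letter (Sum.inl y)) ∈ S := by
    rintro (m | n)
    · exact hs m
    · exact hu n
  induction x using FreeStarAlg.induction with
  | algebraMap c =>
    rw [Algebra.algebraMap_eq_smul_one, coe_smul, map_one]
    exact S.toSubalgebra.smul_mem (one_mem S) c
  | letter x =>
    rcases x with y | y
    · exact h3 y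
    · have e : FreeStarAlg.letter (R := R) (Sum.inr y) =
          star (FreeStarAlg.letter (Sum.inl y)) := by rw [FreeStarAlg.star_letter]; rfl
      rw [e, ← star_coe]
      exact star_mem (h3 y)
  | mul a b ha hb => rw [map_mul]; exact mul_mem ha hb
  | add a b ha hb => rw [map_add]; exact add_mem ha hb

variable [IsDomain R] [hfin : ∀ m : R⁰, Finite (R ⧸ Ideal.span {(m : R)})]
  {A : Type v} [CStarAlgebra A] [Nontrivial A]

theorem isometry_of_nontrivial (hfield : ¬ IsField R) (π : UnivAlg R →⋆ₐ[ℂ] A) : Isometry π := by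
  have h := relations (R := R)
  refine AddMonoidHomClass.isometry_of_norm π fun a =>
    le_antisymm (NonUnitalStarAlgHom.norm_apply_le π a) ?_
  have hπ : Continuous π := AddMonoidHomClass.continuous_of_bound π 1 fun x => by
    simpa using NonUnitalStarAlgHom.norm_apply_le π x
  induction a using induction_on with
  | hp => exact isClosed_le continuous_norm hπ.norm
  | ih x =>
    refine h.norm_le_norm_map hfield π (coe_mem h.homogAlg (fun m => ?_) (fun n => ?_) x)
    · exact Submodule.mem_iSup_of_mem _ (h.s_mem_homog m)
    · exact Submodule.mem_iSup_of_mem _ (h.core_le_homog (h.u_mem_core n))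

/-- The range of an isometry on a complete space is closed, so it contains the closure and not only
the generated `*`-algebra. -/
theorem range_eq (hfield : ¬ IsField R) (π : UnivAlg R →⋆ₐ[ℂ] A) {s' : R⁰ → A} {u' : R → A}
    (hs : ∀ m, π (s m) = s' m) (hu : ∀ n, π (u n) = u' n) :
    π.range = (StarAlgebra.adjoin ℂ (Set.range s' ∪ Set.range u')).topologicalClosure := by
  have hiso := isometry_of_nontrivial hfield π
  apply le_antisymm
  · rintro _ ⟨a, rfl⟩
    change π a ∈ (StarAlgebra.adjoin ℂ (Set.range s' ∪ Set.range u')).topologicalClosure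
    induction a using induction_on with
    | hp => exact (StarSubalgebra.isClosed_topologicalClosure _).preimage hiso.continuous
    | ih x =>
      refine StarSubalgebra.le_topologicalClosure _ ?_
      refine coe_mem ((StarAlgebra.adjoin ℂ (Set.range s' ∪ Set.range u')).comap π)
        (fun m => ?_) (fun n => ?_) x
      · exact StarAlgebra.subset_adjoin ℂ _ (Or.inl ⟨m, (hs m).symm⟩)
      · exact StarAlgebra.subset_adjoin ℂ _ (Or.inr ⟨n, (hu n).symm⟩)
  · refine StarSubalgebra.topologicalClosure_minimal ?_ ?_
    · refine StarAlgebra.adjoin_le ?_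
      rintro _ (⟨m, rfl⟩ | ⟨n, rfl⟩)
      · exact ⟨s m, hs m⟩
      · exact ⟨u n, hu n⟩
    · change IsClosed (Set.range π)
      exact hiso.isClosedEmbedding.isClosed_range

end UnivAlg

/-! ### The regular representation -/

section Regular

variable {R : Type u}

theorem ext_xi {T T' : Ell2 R →L[ℂ] Ell2 R} (h : ∀ r, T (xi r) = T' (xi r)) : T = T' := by
  classical
  ext1 x
  have hx := lp.hasSum_single (p := 2) (by simp) x
  have e : ∀ i, lp.single 2 i (x i) = (x i) • (xi i : Ell2 R) := fun i => by
    rw [xi, ← lp.single_smul, smul_eq_mul, mul_one]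
  simp_rw [e] at hx
  have h1 := hx.mapL T
  have h2 := hx.mapL T'
  simp_rw [map_smul, h] at h1
  simp_rw [map_smul] at h2
  exact h1.unique h2

theorem eq_zero_of_inner_xi {x : Ell2 R} (h : ∀ r, inner ℂ (xi r) x = 0) : x = 0 := by
  classical
  ext r
  have := h r
  rw [xi, lp.inner_single_left] at this
  simpa using this

instance [Nonempty R] : Nontrivial (Ell2 R →L[ℂ] Ell2 R) := by
  obtain ⟨r⟩ := ‹Nonempty R›
  refine ⟨1, 0, fun h => orthonormal_xi.ne_zero r ?_⟩
  exact congrArg (fun T : Ell2 R →L[ℂ] Ell2 R => T (xi r)) h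

variable [CommRing R]

theorem star_regS_mul (m : R⁰) : star (regS m) * regS m = (1 : Ell2 R →L[ℂ] Ell2 R) :=
  LinearIsometry.adjoint_comp_self _

theorem star_regU_mul (n : R) : star (regU n) * regU n = (1 : Ell2 R →L[ℂ] Ell2 R) :=
  LinearIsometry.adjoint_comp_self _

theorem regU_mul_regU (l n : R) : regU l * regU n = regU (l + n) :=
  ext_xi fun r => by
    rw [mul_apply_eq_comp, regU_xi, regU_xi, regU_xi, add_assoc]

theorem regU_mul_star (n : R) : regU n * star (regU n) = (1 : Ell2 R →L[ℂ] Ell2 R) := by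
  have h0 : regU n * regU (-n) = 1 := ext_xi fun r => by
    rw [mul_apply_eq_comp, regU_xi, regU_xi]; simp
  have : star (regU n) = regU (-n) := by
    rw [← mul_one (star _), ← h0, ← mul_assoc, star_regU_mul, one_mul]
  rw [this, h0]

open Classical in
theorem range_regS_xi (m : R⁰) (r : R) :
    (regS m * star (regS m)) (xi r) = if (m : R) ∣ r then xi r else 0 := by
  split_ifs with hr
  · obtain ⟨t, rfl⟩ := hr
    rw [← regS_xi, ← mul_apply_eq_comp, mul_assoc, star_regS_mul, mul_one]
  · have : star (regS m) (xi r) = 0 := eq_zero_of_inner_xi fun j => by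
      rw [ContinuousLinearMap.star_eq_adjoint, ContinuousLinearMap.adjoint_inner_right, regS_xi]
      exact orthonormal_xi.2 fun e => hr ⟨j, e.symm⟩
    rw [mul_apply_eq_comp, this, map_zero]

theorem relations_reg [hfin : ∀ m : R⁰, Finite (R ⧸ Ideal.span {(m : R)})] :
    Relations Eq (regS (R := R)) regU where
  isometry := star_regS_mul
  unitary_left := star_regU_mul
  unitary_right := regU_mul_star
  s_mul_s k m := ext_xi fun r => by
    rw [mul_apply_eq_comp, regS_xi, regS_xi, regS_xi, Submonoid.coe_mul, mul_assoc]
  u_mul_u := regU_mul_regU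
  s_mul_u m n := ext_xi fun r => by
    rw [mul_apply_eq_comp, mul_apply_eq_comp, regS_xi, regU_xi, regS_xi,
      regU_xi, mul_add]
  range_sum m := by
    classical
    have := Fintype.ofFinite (R ⧸ Ideal.span {(m : R)})
    rw [finsum_eq_sum_of_fintype]
    refine ext_xi fun r => ?_
    -- On `ξ_r` only the coset containing `r` contributes.
    have e : ∀ c : R ⧸ Ideal.span {(m : R)},
        (regU c.out * (regS m * star (regS m)) * regU (-c.out)) (xi r) =
          if c = Ideal.Quotient.mk _ r then xi r else 0 := fun c => by
      have hc : c = Ideal.Quotient.mk _ r ↔ (m : R) ∣ -c.out + r := by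
        conv_lhs => rw [← Quotient.out_eq' c, eq_comm]
        rw [neg_add_eq_sub, ← Ideal.mem_span_singleton]
        exact Ideal.Quotient.eq
      rw [mul_apply_eq_comp, mul_apply_eq_comp, regU_xi, range_regS_xi]
      simp only [hc]
      split_ifs
      · rw [regU_xi, add_neg_cancel_left]
      · rw [map_zero]
    rw [sum_apply]
    simp_rw [e]
    simp

end Regular

end RingCStar
end

/-! ### The two isomorphisms -/

theorem mainTheorem3 {R : Type u} [CommRing R] [IsDomain R] (hfield : ¬ IsField R)
    (hfin : ∀ m : R, m ≠ 0 → Finite (R ⧸ Ideal.span {m})) :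
    (∀ (A : Type v) [CStarAlgebra A] [Nontrivial A] (s : R⁰ → A) (u : R → A),
      RingCStar.Relations Eq s u →
      (StarAlgebra.adjoin ℂ (Set.range s ∪ Set.range u)).topologicalClosure = ⊤ →
      ∃! φ : RingCStar.UnivAlg R ≃⋆ₐ[ℂ] A,
        (∀ m, φ (RingCStar.UnivAlg.s m) = s m) ∧ ∀ n, φ (RingCStar.UnivAlg.u n) = u n) ∧
    ∃! φ : RingCStar.UnivAlg R ≃⋆ₐ[ℂ] RingCStar.regAlg R,
      (∀ m, φ (RingCStar.UnivAlg.s m) = ⟨RingCStar.regS m, RingCStar.regS_mem m⟩) ∧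
        ∀ n, φ (RingCStar.UnivAlg.u n) = ⟨RingCStar.regU n, RingCStar.regU_mem n⟩ := by
  have _ : ∀ m : R⁰, Finite (R ⧸ Ideal.span {(m : R)}) :=
    fun m => hfin m (nonZeroDivisors.coe_ne_zero m)
  refine ⟨fun A _ _ s u h htop => ?_, ?_⟩
  · obtain ⟨π, ⟨hs, hu⟩, huniq⟩ := RingCStar.UnivAlg.existsUnique_lift h
    have hr := RingCStar.UnivAlg.range_eq hfield π hs hu
    have hsurj : Function.Surjective π := fun a => by
      have : a ∈ π.range := by rw [hr, htop]; trivial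
      exact this
    refine ⟨StarAlgEquiv.ofBijective π
      ⟨(RingCStar.UnivAlg.isometry_of_nontrivial hfield π).injective, hsurj⟩, ⟨hs, hu⟩, ?_⟩
    rintro ψ ⟨h1, h2⟩
    have := huniq (ψ : RingCStar.UnivAlg R →⋆ₐ[ℂ] A) ⟨h1, h2⟩
    ext a
    exact DFunLike.congr_fun this a
  · obtain ⟨π, ⟨hs, hu⟩, huniq⟩ :=
      RingCStar.UnivAlg.existsUnique_lift (RingCStar.relations_reg (R := R))
    have hr : π.range = RingCStar.regAlg R := RingCStar.UnivAlg.range_eq hfield π hs hu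
    have hmem : ∀ a, π a ∈ RingCStar.regAlg R := fun a => hr ▸ ⟨a, rfl⟩
    refine ⟨StarAlgEquiv.ofBijective (π.codRestrict (RingCStar.regAlg R) hmem) ⟨?_, ?_⟩,
      ⟨fun m => Subtype.ext (hs m), fun n => Subtype.ext (hu n)⟩, ?_⟩
    · exact (StarAlgHom.injective_codRestrict _ _ _).2
        (RingCStar.UnivAlg.isometry_of_nontrivial hfield π).injective
    · rintro ⟨b, hb⟩
      rw [← hr] at hb
      obtain ⟨a, ha⟩ := hb
      exact ⟨a, Subtype.ext ha⟩
    · rintro ψ ⟨h1, h2⟩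
      -- Composition with the inclusion into `L(ℓ²(R))` reduces uniqueness to that of the lift.
      have := huniq ((RingCStar.regAlg R).subtype.comp
        (ψ : RingCStar.UnivAlg R →⋆ₐ[ℂ] RingCStar.regAlg R))
        ⟨fun m => congrArg Subtype.val (h1 m), fun n => congrArg Subtype.val (h2 n)⟩
      exact StarAlgEquiv.ext fun a => Subtype.ext (DFunLike.congr_fun this a)
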